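/- **Theorem 1.** Fix integers $n\ge 1$ and $N\ge 1$. *Invariants.* For each nonempty cyclic word $w$ in letters $X_1,\dots,X_n$ (standing for Hermitian $N\times N$ matrices) let $\mathrm{Tr}_N(w)$ be a formal symbol, put $\mathrm{Tr}_N(1)=N$ for the empty word, and let $\mathcal T$ be the commutative ring of complex polynomials in these symbols (the trace polynomials). Let $\mathbb C_{\langle n\rangle}$ be the free algebra on $X_1,\dots,X_n$, with elements of $\mathcal T$ admitted as scalars, and let $\mathcal A_{n,N}=(\mathbb C_{\langle n\rangle}\otimes\mathbb C_{\langle n\rangle})\oplus(\mathbb C_{\langle n\rangle}\boxtimes\mathbb C_{\langle n\rangle})$, where $\boxtimes$ denotes a second copy of the tensor product; so far it is only a $\mathcal T$-module. *Hessian.* An operator is a product of traces of words, $O=\prod_{r=1}^{t}\mathrm{Tr}_N(w_r)$. Let $\partial_{X_a}$ be the noncommutative derivative ($\partial_{X_a}w=\sum_{w=pX_as}p\otimes s$) and $\mathscr D_{X_a}$ the cyclic derivative ($\mathscr D_{X_a}w=\sum_{w=pX_as}sp$). The Hessian of $O$ is the $n\times n$ array with entries in $\mathcal A_{n,N}$ $$\mathrm{Hess}_{a,b}\,O=\sum_r\Big(\prod_{t\ne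 r}\mathrm{Tr}_N w_t\Big)\,\partial_{X_a}\mathscr D_{X_b}w_r+\sum_{r\neq s}\Big(\prod_{t\neq r,s}\mathrm{Tr}_N w_t\Big)\,\mathscr D_{X_a}w_r\boxtimes\mathscr D_{X_b}w_s .$$ It is the sum, over ordered pairs of distinct half-edges (letters) $X_a$, $X_b$ of $O$, of summands in the entry $(a,b)$: if $O=\mathrm{Tr}_N(X_a\,y\,X_b\,x)\prod_j\mathrm{Tr}_N(u_j)$ with both marked letters in one trace, the summand is $\prod_j\mathrm{Tr}_N(u_j)\,x\otimes y$; if $O=\mathrm{Tr}_N(X_a\,x)\,\mathrm{Tr}_N(X_b\,y)\prod_j\mathrm{Tr}_N(u_j)$ with the marked letters in different traces, it is $\prod_j\mathrm{Tr}_N(u_j)\,x\boxtimes y$. Let $\Gamma^{\rm Int}=\sum_O\bar g_O\,O$ range over the real finite linear combinations of operators with nonempty words and different from the kinetic operators $\mathrm{Tr}_N(X_c^2)$; its Hessian is $\sum_O\bar g_O\,\mathrm{Hess}\,O$. *Ribbon graphs.* A sequence of $m\ge1$ summands of $\mathrm{Hess}\,\Gamma^{\rm Int}$, the $i$-th one with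 marked half-edges $X_{a_i},X_{b_i}$, forms a ribbon graph if $b_i=a_{i+1}$ for all $i$ (cyclically); a propagator then joins the second marked half-edge of the $i$-th operator to the first marked half-edge of the $(i+1)$-st. The effective vertex $O_G^{\rm eff}$ of a ribbon graph $G$ is the product of $\mathrm{Tr}_N(w)$ over the words $w$ read along the closed sides of the propagators, and of the traces met by no propagator. $G$ is one-loop if its skeleton (operators collapsed to points, propagators to edges) is one-particle irreducible, i.e. connected and still connected after deleting any one edge, with first Betti number $1$. *Assumption.* Let $\star$ be any $\mathcal T$-bilinear product on the module $M_n(\mathcal A_{n,N})$ of $n\times n$ arrays over $\mathcal A_{n,N}$, and $\mathrm{STr}:M_n(\mathcal A_{n,N})\to\mathcal T$ any $\mathcal T$-linear functional. Suppose the right-hand side of the Wetterich equation is the geometric series $$\sum_{m}\bar h_m\cdot\tfrac12(-1)^m\,\mathrm{STr}\{(\mathrm{Hess}\,\Gamma^{\rm Int})^{\star m}\},$$ with $\bar h_m$ carrying all dependence on the regulator. We say that *only one-loop graphs are generated* if, for every $\Gamma^{\rm Int}$ and $m\ge1$, each term in the multilinear expansion of $\mathrm{STr}\{(\mathrm{Hess}\,\Gamma^{\rm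 Int})^{\star m}\}$ (powers bracketed from the left), i.e. each sequence of $m$ summands of $\mathrm{Hess}\,\Gamma^{\rm Int}$, contributes the product of its coupling constants times $O^{\rm eff}_G$ if it forms a one-loop ribbon graph $G$, and $0$ otherwise. *Conclusion.* There are a $\mathcal T$-bilinear product $\star$ on $\mathcal A_{n,N}$, associative and with unit $1_N\otimes1_N$, and a $\mathcal T$-linear functional $\mathrm{Tr}_{\mathcal A}$ on $\mathcal A_{n,N}$ such that for all $P,Q,U,W\in\mathbb C_{\langle n\rangle}$ $$\begin{aligned}(U\otimes W)\star(P\otimes Q)&=PU\otimes WQ,&(U\boxtimes W)\star(P\otimes Q)&=U\boxtimes PWQ,\\(U\otimes W)\star(P\boxtimes Q)&=WPU\boxtimes Q,&(U\boxtimes W)\star(P\boxtimes Q)&=\mathrm{Tr}_N(WP)\,U\boxtimes Q,\end{aligned}$$ $\mathrm{Tr}_{\mathcal A}(P\otimes Q)=\mathrm{Tr}_N(P)\,\mathrm{Tr}_N(Q)$ and $\mathrm{Tr}_{\mathcal A}(P\boxtimes Q)=\mathrm{Tr}_N(PQ)$; and only one-loop graphs are generated by $(\star,\mathrm{STr})$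 on $M_n(\mathcal A_{n,N})$ if and only if $\star$ is the product of the matrix algebra over it, $(\mathcal P\star\mathcal Q)_{a,c}=\sum_{b=1}^n\mathcal P_{a,b}\star\mathcal Q_{b,c}$, and $\mathrm{STr}(\mathcal P)=\sum_{a=1}^n\mathrm{Tr}_{\mathcal A}(\mathcal P_{a,a})$. In that case, for every $\Gamma^{\rm Int}$ and $m\ge1$, $\tfrac12(-1)^m\mathrm{STr}\{(\mathrm{Hess}\,\Gamma^{\rm Int})^{\star m}\}$ is $\tfrac12(-1)^m$ times the sum, over all sequences of $m$ summands of $\mathrm{Hess}\,\Gamma^{\rm Int}$ that form a one-loop graph $G$, of the product of the coupling constants times $O^{\rm eff}_G$. -/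

import Mathlib

open scoped TensorProduct BigOperators

noncomputable section

namespace FRG

/-! ### Words, traces, the free algebra -/

/-- Words (monomials) in the letters `X_1, …, X_n`. -/
abbrev Word (n : ℕ) := List (Fin n)

/-- The commutative ring of trace polynomials (the `U(N)`-invariants): polynomials over `ℂ` in
the symbols `Tr(w)`, one for each nonempty cyclic word `w`. -/
abbrev TraceRing (n : ℕ) := MvPolynomial {c : Cycle (Fin n) // c ≠ Cycle.nil} ℂ

/-- `Tr_N(w)` for a word `w`. The empty word is the unit matrix `1_N`, so its trace is `N`. -/
def trWord {n : ℕ} (N : ℕ) (w : Word n) : TraceRing n :=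
  if h : (w : Cycle (Fin n)) ≠ Cycle.nil then MvPolynomial.X ⟨(w : Cycle (Fin n)), h⟩
  else MvPolynomial.C (N : ℂ)

/-- `Tr_N(w_1) ⋯ Tr_N(w_t)`. -/
def trProd {n : ℕ} (N : ℕ) (l : List (Word n)) : TraceRing n := (l.map (trWord N)).prod

/-- The free algebra on `X_1, …, X_n`; traces are admitted as scalars. -/
abbrev Free (n : ℕ) := FreeAlgebra (TraceRing n) (Fin n)

/-- A word as an element of the free algebra. -/
def mono {n : ℕ} (w : Word n) : Free n := FreeAlgebra.basisFreeMonoid _ _ (FreeMonoid.ofList w)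

/-- The trace `Tr_N` on the free algebra. -/
def Tr {n : ℕ} (N : ℕ) : Free n →ₗ[TraceRing n] TraceRing n :=
  (FreeAlgebra.basisFreeMonoid (TraceRing n) (Fin n)).constr (TraceRing n)
    fun w => trWord N w.toList

/-! ### The space `𝒜_n` and the `n × n` matrices over it -/

/-- The module `𝒜_n = (ℂ⟨n⟩ ⊗ ℂ⟨n⟩) ⊕ (ℂ⟨n⟩ ⊠ ℂ⟨n⟩)`. It carries no product. -/
abbrev A (n : ℕ) :=
  (Free n ⊗[TraceRing n] Free n) × (Free n ⊗[TraceRing n] Free n)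

/-- `U ⊗ W` in the first summand of `𝒜_n`. -/
def tens {n : ℕ} (U W : Free n) : A n := (U ⊗ₜ[TraceRing n] W, 0)

/-- `U ⊠ W` in the second summand of `𝒜_n`. -/
def box {n : ℕ} (U W : Free n) : A n := (0, U ⊗ₜ[TraceRing n] W)

/-- The module of `n × n` arrays with entries in `𝒜_n`, in which Hessians live. -/
abbrev MA (n : ℕ) := Matrix (Fin n) (Fin n) (A n)

/-! ### Noncommutative derivatives and the Hessian -/

/-- `w` with the letter at position `j` removed, rooted at the letter after the removed one. -/
def excise {n : ℕ} (w : Word n) (j : ℕ) : Word n := w.drop (j + 1) ++ w.take j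

/-- The noncommutative derivative `∂_{X_a}`. -/
def ncDeriv {n : ℕ} (a : Fin n) : Free n →ₗ[TraceRing n] Free n ⊗[TraceRing n] Free n :=
  (FreeAlgebra.basisFreeMonoid (TraceRing n) (Fin n)).constr (TraceRing n) fun w =>
    ∑ i : Fin w.toList.length, if w.toList.get i = a then
      mono (w.toList.take i) ⊗ₜ[TraceRing n] mono (w.toList.drop (i + 1)) else 0

/-- The cyclic derivative `𝒟_{X_b} w = ∂_{X_b} Tr w`. -/
def cycDeriv {n : ℕ} (b : Fin n) (w : Word n) : Free n :=
  ∑ j : Fin w.length, if w.get j = b then mono (excise w j) else 0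

/-- A (multi-trace) operator `Tr(w_1) ⋯ Tr(w_t)`, given by the list of its words. -/
abbrev Operator (n : ℕ) := List (Word n)

/-- The words of `O` except those with index in `S`. -/
def others {n : ℕ} (O : Operator n) (S : Finset (Fin O.length)) : List (Word n) :=
  ((List.finRange O.length).filter (· ∉ S)).map O.get

/-- The noncommutative Hessian of an operator. Both derivatives may hit the same trace, which
gives `∂_{X_a} (∂_{X_b} Tr w)`, or two different traces, which gives `𝒟_{X_a} w ⊠ 𝒟_{X_b} w'`. -/
def hessOp {n : ℕ} (N : ℕ) (O : Operator n) : MA n := Matrix.of fun a b =>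
  ∑ r, trProd N (others O {r}) • ((ncDeriv a (cycDeriv b (O.get r)), 0) : A n) +
  ∑ p : {p : Fin O.length × Fin O.length // p.1 ≠ p.2},
    trProd N (others O {p.1.1, p.1.2}) •
      box (cycDeriv a (O.get p.1.1)) (cycDeriv b (O.get p.1.2))

/-- Interaction vertices: every operator except the kinetic ones, `Tr(X_c X_c)`. Factors
`Tr(1_N) = N` are counted as part of the coupling constant. -/
def IsInteraction {n : ℕ} (O : Operator n) : Prop :=
  (∀ w ∈ O, w ≠ []) ∧ ∀ c : Fin n, O ≠ [[c, c]]

/-- The interaction part `Γ^Int = ∑_O g_O O` of an effective action: finitely many interaction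
vertices with coupling constants. It is real on Hermitian matrices (Hermitian conjugation
reverses words). -/
structure Interaction (n : ℕ) where
  coupling : Operator n →₀ ℂ
  isInteraction : ∀ O ∈ coupling.support, IsInteraction O
  isReal : ∀ O, coupling (O.map List.reverse) = (starRingEnd ℂ) (coupling O)

/-- The noncommutative Hessian of `Γ^Int`. -/
def hess {n : ℕ} (N : ℕ) (Γ : Interaction n) : MA n :=
  ∑ O : Γ.coupling.support,
    (MvPolynomial.C (Γ.coupling O) : TraceRing n) • hessOp N (O : Operator n)

/-! ### The individual summands of the Hessian -/

/-- An interaction vertex with an ordered pair of marked half-edges `X_a`, `X_b`.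
If `split = false`, the marked half-edges lie on the same trace and the vertex is
`Tr(X_a y X_b x) · ∏ Tr(spect)`; if `split = true`, they lie on different traces and the vertex
is `Tr(X_a x) Tr(X_b y) · ∏ Tr(spect)`. -/
structure MarkedVertex (n : ℕ) where
  a : Fin n
  b : Fin n
  x : Word n
  y : Word n
  split : Bool
  spect : List (Word n)

/-- The summand of the Hessian that belongs to a marked vertex: at the entry `(a, b)` it is
`x ⊗ y` or `x ⊠ y`, times the traces without marks. -/
def MarkedVertex.entry {n : ℕ} (N : ℕ) (m : MarkedVertex n) : MA n :=
  Matrix.single m.a m.b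
    (trProd N m.spect • if m.split then box (mono m.x) (mono m.y) else tens (mono m.x) (mono m.y))

/-- Ordered pairs of distinct half-edges of `O`: on one trace `r` (remove the letter at position
`j` and root there, then choose a letter of the remaining word), or on two different traces. -/
abbrev Mark {n : ℕ} (O : Operator n) :=
  (Σ r : Fin O.length, Σ j : Fin (O.get r).length, Fin (excise (O.get r) j).length) ⊕
  (Σ p : {p : Fin O.length × Fin O.length // p.1 ≠ p.2},
    Fin (O.get p.1.1).length × Fin (O.get p.1.2).length)

/-- The marked vertex given by a pair of half-edges of `O`. -/
def Mark.vertex {n : ℕ} {O : Operator n} : Mark O → MarkedVertex n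
  | Sum.inl ⟨r, j, i⟩ =>
    { a := (excise (O.get r) j).get i
      b := (O.get r).get j
      x := (excise (O.get r) j).take i
      y := (excise (O.get r) j).drop (i + 1)
      split := false
      spect := others O {r} }
  | Sum.inr ⟨p, i, j⟩ =>
    { a := (O.get p.1.1).get i
      b := (O.get p.1.2).get j
      x := excise (O.get p.1.1) i
      y := excise (O.get p.1.2) j
      split := true
      spect := others O {p.1.1, p.1.2} }

/-- The summands of `Hess Γ^Int`: an operator that occurs in it, with an ordered pair of
half-edges. -/
abbrev Summand {n : ℕ} (Γ : Interaction n) :=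
  Σ O : Γ.coupling.support, Mark (O : Operator n)

/-- The coupling constant of a summand. -/
def Summand.coupling {n : ℕ} {Γ : Interaction n} (s : Summand Γ) : TraceRing n :=
  MvPolynomial.C (Γ.coupling s.1)

/-- The marked vertex of a summand. -/
def Summand.vertex {n : ℕ} {Γ : Interaction n} (s : Summand Γ) : MarkedVertex n :=
  Mark.vertex s.2

/-- The value of a summand. -/
def Summand.value {n : ℕ} (N : ℕ) {Γ : Interaction n} (s : Summand Γ) : MA n :=
  s.coupling • s.vertex.entry N

theorem ncDeriv_mono {n : ℕ} (a : Fin n) (w : Word n) :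
    ncDeriv a (mono w) = ∑ i : Fin w.length, if w.get i = a then
      mono (w.take i) ⊗ₜ[TraceRing n] mono (w.drop (i + 1)) else 0 := by
  unfold ncDeriv
  conv_lhs => rw [mono]
  rw [Module.Basis.constr_basis]
  rfl

theorem Tr_mono {n : ℕ} (N : ℕ) (w : Word n) : Tr N (mono w) = trWord N w := by
  unfold Tr mono
  rw [Module.Basis.constr_basis]
  rfl

/-- The Hessian of an operator is the sum over its ordered pairs of half-edges. -/
theorem hessOp_eq_sum {n : ℕ} (N : ℕ) (O : Operator n) :
    hessOp N O = ∑ m : Mark O, m.vertex.entry N := by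
  ext1 a b
  rw [Matrix.sum_apply, Fintype.sum_sum_type, Fintype.sum_sigma, Fintype.sum_sigma]
  simp only [hessOp, Matrix.of_apply, Mark.vertex, MarkedVertex.entry, Matrix.single_apply]
  congr 1
  · refine Finset.sum_congr rfl fun r _ => ?_
    rw [Fintype.sum_sigma, cycDeriv, map_sum]
    have key : ∀ t : Free n ⊗[TraceRing n] Free n, ((t, 0) : A n) =
        LinearMap.inl (TraceRing n) _ _ t := fun _ => rfl
    rw [key, map_sum, Finset.smul_sum]
    refine Finset.sum_congr rfl fun j _ => ?_
    by_cases hb : (O.get r).get j = b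
    · rw [if_pos hb, ncDeriv_mono, map_sum, Finset.smul_sum]
      refine Finset.sum_congr rfl fun i _ => ?_
      by_cases ha : (excise (O.get r) j).get i = a
      · rw [if_pos ha, if_pos ⟨ha, hb⟩]
        rfl
      · rw [if_neg ha, if_neg fun h => ha h.1, map_zero, smul_zero]
    · rw [if_neg hb, map_zero, map_zero, smul_zero]
      exact (Finset.sum_eq_zero fun i _ => if_neg fun h => hb h.2).symm
  · refine Finset.sum_congr rfl fun p _ => ?_
    rw [Fintype.sum_prod_type]
    have key : ∀ u v : Free n, box u v = LinearMap.inr (TraceRing n) (Free n ⊗[TraceRing n] Free n)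
        _ (TensorProduct.mk (TraceRing n) _ _ u v) := fun _ _ => rfl
    rw [key, cycDeriv, cycDeriv]
    simp only [map_sum, LinearMap.sum_apply, Finset.smul_sum]
    rw [Finset.sum_comm]
    refine Finset.sum_congr rfl fun i _ => Finset.sum_congr rfl fun j _ => ?_
    by_cases ha : (O.get p.1.1).get i = a <;> by_cases hb : (O.get p.1.2).get j = b <;>
      simp_all [box]

/-- The Hessian of `Γ^Int` is the sum of its summands. -/
theorem hess_eq_sum {n : ℕ} (N : ℕ) (Γ : Interaction n) :
    hess N Γ = ∑ s : Summand Γ, s.value N := by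
  unfold hess
  rw [Fintype.sum_sigma]
  refine Finset.sum_congr rfl fun O _ => ?_
  rw [hessOp_eq_sum, Finset.smul_sum]
  rfl

/-! ### Ribbon graphs and effective vertices -/

/-- A ribbon graph of a multi-trace multi-matrix model. `V` are the interaction vertices and `H`
the half-edges that are contracted by propagators. The traces of an interaction vertex that meet
a propagator are the cycles of `next`, which sends a contracted half-edge to the next contracted
one on the same trace; `leg h` is the word of the uncontracted half-edges strictly between `h`
and `next h`. The remaining traces of `v` are `Tr(w)`, `w ∈ spect v`. Propagators join
half-edges with the same matrix. -/
structure RibbonGraph (n : ℕ) where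
  V : Type
  H : Type
  [fintypeV : Fintype V]
  [fintypeH : Fintype H]
  vert : H → V
  letter : H → Fin n
  next : Equiv.Perm H
  vert_next : ∀ h, vert (next h) = vert h
  prop : Equiv.Perm H
  prop_prop : ∀ h, prop (prop h) = h
  prop_ne : ∀ h, prop h ≠ h
  letter_prop : ∀ h, letter (prop h) = letter h
  leg : H → Word n
  spect : V → List (Word n)

namespace RibbonGraph

attribute [instance] RibbonGraph.fintypeV RibbonGraph.fintypeH

/-- Travelling along a side of the ribbons: read the legs after `h`, arrive at `next h`, cross its
propagator. -/
def face {n : ℕ} (G : RibbonGraph n) : Equiv.Perm G.H := G.next.trans G.prop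

/-- The word listed along the closed side that starts with the legs after `h`. -/
def faceWord {n : ℕ} (G : RibbonGraph n) (h : G.H) : Word n :=
  ((List.range (Function.minimalPeriod G.face h)).map fun j => G.leg ((G.face ^ j) h)).flatten

open Classical in
/-- The effective vertex `O_G^eff`: the product of the traces of the words along the closed sides
of the ribbons (from an arbitrary starting point) and of the uncontracted traces. -/
def effVertex {n : ℕ} (N : ℕ) (G : RibbonGraph n) : TraceRing n :=
  (∏ f : Quotient (Equiv.Perm.SameCycle.setoid G.face), trWord N (G.faceWord f.out)) *
    ∏ v : G.V, trProd N (G.spect v)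

/-- Adjacency in the skeleton `G°` (interaction vertices collapsed to points, propagators to
edges), when the edges of the half-edges in `S` are deleted. -/
def Link {n : ℕ} (G : RibbonGraph n) (S : Set G.H) (u v : G.V) : Prop :=
  ∃ h, h ∉ S ∧ G.vert h = u ∧ G.vert (G.prop h) = v

/-- The skeleton without the edges of the half-edges in `S` is connected. -/
def ConnectedWithout {n : ℕ} (G : RibbonGraph n) (S : Set G.H) : Prop :=
  Nonempty G.V ∧ ∀ u v, Relation.ReflTransGen (G.Link S) u v

/-- One-particle irreducible: the skeleton is connected, and stays so after deleting any edge. -/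
def IsOnePI {n : ℕ} (G : RibbonGraph n) : Prop :=
  G.ConnectedWithout ∅ ∧ ∀ h, G.ConnectedWithout {h, G.prop h}

/-- The first Betti number of the skeleton, `#edges - #vertices + #components`. -/
def betti {n : ℕ} (G : RibbonGraph n) : ℤ :=
  (Nat.card (Quotient (Equiv.Perm.SameCycle.setoid G.prop)) : ℤ) - Nat.card G.V +
    Nat.card (Quot (G.Link ∅))

/-- One-loop graphs: the skeleton is one-particle irreducible with first Betti number `1`. -/
def IsOneLoop {n : ℕ} (G : RibbonGraph n) : Prop := G.IsOnePI ∧ G.betti = 1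

end RibbonGraph

/-! ### The graphs generated by powers of the Hessian -/

/-- The second marked half-edge of each vertex carries the same matrix as the first marked
half-edge of the cyclically next vertex, so that they can be joined by a propagator. -/
def Closes {n k : ℕ} (m : Fin (k + 1) → MarkedVertex n) : Prop := ∀ i, (m i).b = (m (i + 1)).a

/-- The next marked half-edge on the same trace. The marked half-edges of the `i`-th vertex are
`(i, false)` (the first one, `X_a`) and `(i, true)` (the second one, `X_b`). -/
def loopNext {n k : ℕ} (m : Fin (k + 1) → MarkedVertex n) : Equiv.Perm (Fin (k + 1) × Bool) where
  toFun h := if (m h.1).split then h else (h.1, !h.2)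
  invFun h := if (m h.1).split then h else (h.1, !h.2)
  left_inv h := by by_cases hs : (m h.1).split <;> simp [hs]
  right_inv h := by by_cases hs : (m h.1).split <;> simp [hs]

/-- Propagators join the second half-edge of a vertex with the first one of the next vertex. -/
def loopProp (k : ℕ) : Equiv.Perm (Fin (k + 1) × Bool) where
  toFun h := if h.2 then (h.1 + 1, false) else (h.1 - 1, true)
  invFun h := if h.2 then (h.1 + 1, false) else (h.1 - 1, true)
  left_inv := by rintro ⟨i, _ | _⟩ <;> simp
  right_inv := by rintro ⟨i, _ | _⟩ <;> simp

/-- The ribbon graph obtained from `k + 1` marked vertices by joining the second marked half-edge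
`(i, true)` of the `i`-th vertex with the first marked half-edge `(i + 1, false)` of the
cyclically next one. -/
def loopGraph {n k : ℕ} (m : Fin (k + 1) → MarkedVertex n) (hm : Closes m) : RibbonGraph n where
  V := Fin (k + 1)
  H := Fin (k + 1) × Bool
  vert h := h.1
  letter h := if h.2 then (m h.1).b else (m h.1).a
  next := loopNext m
  vert_next h := by
    by_cases hs : (m h.1).split <;> simp [loopNext, hs]
  prop := loopProp k
  prop_prop := by rintro ⟨i, _ | _⟩ <;> simp [loopProp]
  prop_ne := by rintro ⟨i, _ | _⟩ <;> simp [loopProp]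
  letter_prop := by
    rintro ⟨i, _ | _⟩
    · simpa [loopProp] using hm (i - 1)
    · simpa [loopProp] using (hm i).symm
  leg h := if (m h.1).split = h.2 then (m h.1).y else (m h.1).x
  spect i := (m i).spect

open Classical in
/-- The contribution of a sequence of marked vertices that only one-loop graphs allow: the
effective vertex if the marked vertices form a one-loop ribbon graph, and `0` otherwise. -/
def loopContribution {n k : ℕ} (N : ℕ) (m : Fin (k + 1) → MarkedVertex n) : TraceRing n :=
  if hm : Closes m then
    if (loopGraph m hm).IsOneLoop then (loopGraph m hm).effVertex N else 0
  else 0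

/-- The product `((f 0 ⋆ f 1) ⋆ f 2) ⋆ ⋯ ⋆ f k`. -/
def starProd {n : ℕ} (star : MA n →ₗ[TraceRing n] MA n →ₗ[TraceRing n] MA n) :
    (k : ℕ) → (Fin (k + 1) → MA n) → MA n
  | 0, f => f 0
  | k + 1, f => star (starProd star k fun i => f i.castSucc) (f (Fin.last (k + 1)))

/-- The regulator-independent part `½ (-1)^m STr{(Hess Γ^Int)^{⋆m}}`, `m = k + 1`, of the term of
order `m` in the geometric series for the right hand side of the Wetterich equation. -/
def wetterichTerm {n : ℕ} (N : ℕ)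
    (star : MA n →ₗ[TraceRing n] MA n →ₗ[TraceRing n] MA n) (STr : MA n →ₗ[TraceRing n] TraceRing n)
    (Γ : Interaction n) (k : ℕ) : TraceRing n :=
  MvPolynomial.C ((1 / 2 : ℂ) * (-1) ^ (k + 1)) * STr (starProd star k fun _ => hess N Γ)

/-- Only one-loop graphs are generated: for every `Γ^Int` and every choice of `k + 1` summands of
`Hess Γ^Int`, the corresponding term in the expansion of `STr{(Hess Γ^Int)^{⋆(k+1)}}` is the
product of the coupling constants times the effective vertex of the one-loop ribbon graph that
the summands form, and it vanishes if they do not form one. -/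
def GeneratesOnlyOneLoop {n : ℕ} (N : ℕ)
    (star : MA n →ₗ[TraceRing n] MA n →ₗ[TraceRing n] MA n)
    (STr : MA n →ₗ[TraceRing n] TraceRing n) : Prop :=
  ∀ (Γ : Interaction n) (k : ℕ) (s : Fin (k + 1) → Summand Γ),
    STr (starProd star k fun i => (s i).value N) =
      (∏ i, (s i).coupling) * loopContribution N fun i => (s i).vertex

end FRG

end

open scoped TensorProduct BigOperators

noncomputable section

namespace FRG

variable {n : ℕ}

/-! ### Words in the free algebra -/

theorem mono_mul (u v : Word n) : (mono u * mono v : Free n) = mono (u ++ v) := by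
  simp [mono, FreeAlgebra.basisFreeMonoid, FreeMonoid.ofList_append,
    ← map_mul, MonoidAlgebra.single_mul_single]

theorem free_induction {p : Free n → Prop} (hm : ∀ w, p (mono w)) (ha : ∀ x y, p x → p y → p (x + y))
    (hs : ∀ (r : TraceRing n) x, p x → p (r • x)) (x : Free n) : p x := by
  have hx : x ∈ Submodule.span (TraceRing n)
      (Set.range (FreeAlgebra.basisFreeMonoid (TraceRing n) (Fin n))) := by
    rw [Module.Basis.span_eq]; trivial
  induction hx using Submodule.span_induction with
  | mem x h => obtain ⟨w, rfl⟩ := h; exact hm w.toList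
  | zero => simpa using hs 0 _ (hm [])
  | add x y _ _ hx hy => exact ha x y hx hy
  | smul r x _ hx => exact hs r x hx

theorem trWord_eq_of_isRotated (N : ℕ) {u v : Word n} (h : u ~r v) : trWord N u = trWord N v := by
  have : (u : Cycle (Fin n)) = v := Cycle.coe_eq_coe.2 h
  unfold trWord
  rw [this]

theorem trWord_append_comm (N : ℕ) (u v : Word n) : trWord N (u ++ v) = trWord N (v ++ u) :=
  trWord_eq_of_isRotated N List.isRotated_append

theorem Tr_mul_comm (N : ℕ) (x y : Free n) : Tr N (x * y) = Tr N (y * x) := by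
  induction x using free_induction with
  | hm u =>
    induction y using free_induction with
    | hm v => rw [mono_mul, mono_mul, Tr_mono, Tr_mono, trWord_append_comm]
    | ha a b ha hb => simp only [mul_add, add_mul, map_add, ha, hb]
    | hs r a ha => simp only [mul_smul_comm, smul_mul_assoc, map_smul, ha]
  | ha a b ha hb => simp only [mul_add, add_mul, map_add, ha, hb]
  | hs r a ha => simp only [mul_smul_comm, smul_mul_assoc, map_smul, ha]

/-! ### The algebra structure on `𝒜` -/

/-- `F ⊗ F` acting on itself by `(U ⊗ W) ↦ U ⊗ P W Q`. -/
def innerRight : (Free n ⊗[TraceRing n] Free n) →ₗ[TraceRing n]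
    (Free n ⊗[TraceRing n] Free n) →ₗ[TraceRing n] Free n ⊗[TraceRing n] Free n :=
  TensorProduct.lift <| LinearMap.mk₂ (TraceRing n)
    (fun P Q => LinearMap.lTensor (Free n)
      (LinearMap.mulLeft (TraceRing n) P ∘ₗ LinearMap.mulRight (TraceRing n) Q))
    (fun P P' Q => by ext; simp [add_mul, TensorProduct.tmul_add])
    (fun r P Q => by ext; simp)
    (fun P Q Q' => by ext; simp [mul_add, TensorProduct.tmul_add])
    (fun r P Q => by ext; simp)

theorem innerRight_tmul (P Q U W : Free n) :
    innerRight (P ⊗ₜ Q) (U ⊗ₜ W) = U ⊗ₜ[TraceRing n] (P * W * Q) := by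
  simp [innerRight, mul_assoc]

/-- `F ⊗ F` acting on itself by `(P ⊗ Q) ↦ W P U ⊗ Q`. -/
def innerLeft : (Free n ⊗[TraceRing n] Free n) →ₗ[TraceRing n]
    (Free n ⊗[TraceRing n] Free n) →ₗ[TraceRing n] Free n ⊗[TraceRing n] Free n :=
  TensorProduct.lift <| LinearMap.mk₂ (TraceRing n)
    (fun U W => LinearMap.rTensor (Free n)
      (LinearMap.mulLeft (TraceRing n) W ∘ₗ LinearMap.mulRight (TraceRing n) U))
    (fun P P' Q => by ext; simp [mul_add, TensorProduct.add_tmul])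
    (fun r P Q => by ext; simp [TensorProduct.smul_tmul'])
    (fun P Q Q' => by ext; simp [add_mul, TensorProduct.add_tmul])
    (fun r P Q => by ext; simp [TensorProduct.smul_tmul'])

theorem innerLeft_tmul (U W P Q : Free n) :
    innerLeft (U ⊗ₜ W) (P ⊗ₜ Q) = (W * P * U) ⊗ₜ[TraceRing n] Q := by
  simp [innerLeft, mul_assoc]

/-- The contraction `(U ⊗ W, P ⊗ Q) ↦ Tr (W P) U ⊗ Q`. -/
def contract (N : ℕ) : (Free n ⊗[TraceRing n] Free n) →ₗ[TraceRing n]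
    (Free n ⊗[TraceRing n] Free n) →ₗ[TraceRing n] Free n ⊗[TraceRing n] Free n :=
  TensorProduct.lift <| LinearMap.mk₂ (TraceRing n)
    (fun U W => TensorProduct.mk (TraceRing n) _ _ U ∘ₗ
      (TensorProduct.lid (TraceRing n) (Free n)).toLinearMap ∘ₗ
      LinearMap.rTensor (Free n) (Tr N ∘ₗ LinearMap.mulLeft (TraceRing n) W))
    (fun P P' Q => by ext; simp)
    (fun r P Q => by ext; simp [TensorProduct.smul_tmul'])
    (fun P Q Q' => by ext; simp [add_mul, add_smul, TensorProduct.tmul_add])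
    (fun r P Q => by ext; simp [mul_smul])

theorem contract_tmul (N : ℕ) (U W P Q : Free n) :
    contract N (U ⊗ₜ W) (P ⊗ₜ Q) = Tr N (W * P) • U ⊗ₜ[TraceRing n] Q := by
  simp [contract]

/-- The product `⋆` on `𝒜`. -/
def mulA (N : ℕ) : A n →ₗ[TraceRing n] A n →ₗ[TraceRing n] A n :=
  LinearMap.mk₂ (TraceRing n)
    (fun x y => (TensorProduct.map₂ (LinearMap.mul (TraceRing n) (Free n)).flip
        (LinearMap.mul (TraceRing n) (Free n)) x.1 y.1,
      innerLeft x.1 y.2 + innerRight y.1 x.2 + contract N x.2 y.2))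
    (fun x x' y => by
      ext <;> simp only [Prod.fst_add, Prod.snd_add, map_add, LinearMap.add_apply]
      abel)
    (fun r x y => by
      ext <;> simp only [Prod.smul_fst, Prod.smul_snd, map_smul, LinearMap.smul_apply, smul_add])
    (fun x x' y => by
      ext <;> simp only [Prod.fst_add, Prod.snd_add, map_add, LinearMap.add_apply]
      abel)
    (fun r x y => by
      ext <;> simp only [Prod.smul_fst, Prod.smul_snd, map_smul, LinearMap.smul_apply, smul_add])

theorem mulA_apply (N : ℕ) (x y : A n) : mulA N x y =
    (TensorProduct.map₂ (LinearMap.mul (TraceRing n) (Free n)).flip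
        (LinearMap.mul (TraceRing n) (Free n)) x.1 y.1,
      innerLeft x.1 y.2 + innerRight y.1 x.2 + contract N x.2 y.2) := rfl

theorem mulA_tens_tens (N : ℕ) (U W P Q : Free n) :
    mulA N (tens U W) (tens P Q) = tens (P * U) (W * Q) := by
  simp [mulA_apply, tens]

theorem mulA_box_tens (N : ℕ) (U W P Q : Free n) :
    mulA N (box U W) (tens P Q) = box U (P * W * Q) := by
  simp [mulA_apply, tens, box, innerRight_tmul]

theorem mulA_tens_box (N : ℕ) (U W P Q : Free n) :
    mulA N (tens U W) (box P Q) = box (W * P * U) Q := by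
  simp [mulA_apply, tens, box, innerLeft_tmul]

theorem mulA_box_box (N : ℕ) (U W P Q : Free n) :
    mulA N (box U W) (box P Q) = Tr N (W * P) • box U Q := by
  simp [mulA_apply, box, contract_tmul]

/-- The trace on `𝒜`. -/
def trA (N : ℕ) : A n →ₗ[TraceRing n] TraceRing n :=
  LinearMap.coprod
    (LinearMap.mul' (TraceRing n) (TraceRing n) ∘ₗ TensorProduct.map (Tr N) (Tr N))
    (Tr N ∘ₗ LinearMap.mul' (TraceRing n) (Free n))

theorem trA_tens (N : ℕ) (P Q : Free n) : trA N (tens P Q) = Tr N P * Tr N Q := by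
  simp [trA, tens]

theorem trA_box (N : ℕ) (P Q : Free n) : trA N (box P Q) = Tr N (P * Q) := by
  simp [trA, box]

theorem A_induction {p : A n → Prop} (ht : ∀ U W, p (tens U W)) (hb : ∀ U W, p (box U W))
    (ha : ∀ x y, p x → p y → p (x + y)) (x : A n) : p x := by
  obtain ⟨t, s⟩ := x
  have h : ((t, s) : A n) = (t, 0) + (0, s) := by simp
  rw [h]
  clear h
  refine ha _ _ ?_ ?_
  · induction t using TensorProduct.induction_on with
    | zero => simpa [tens] using ht 0 0
    | tmul U W => exact ht U W
    | add x y hx hy => simpa using ha _ _ hx hy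
  · induction s using TensorProduct.induction_on with
    | zero => simpa [tens] using ht 0 0
    | tmul U W => exact hb U W
    | add x y hx hy => simpa using ha _ _ hx hy

theorem mulA_assoc (N : ℕ) (x y z : A n) :
    mulA N (mulA N x y) z = mulA N x (mulA N y z) := by
  induction x using A_induction with
  | ha x x' hx hx' => simp only [map_add, LinearMap.add_apply, hx, hx']
  | ht U W =>
    induction y using A_induction with
    | ha x x' hx hx' => simp only [map_add, LinearMap.add_apply, hx, hx']
    | ht P Q =>
      induction z using A_induction with
      | ha x x' hx hx' => simp only [map_add, hx, hx']
      | ht K L => simp only [mulA_tens_tens, mul_assoc]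
      | hb K L => simp only [mulA_tens_tens, mulA_tens_box, mul_assoc]
    | hb P Q =>
      induction z using A_induction with
      | ha x x' hx hx' => simp only [map_add, hx, hx']
      | ht K L => simp only [mulA_box_tens, mulA_tens_box, mul_assoc]
      | hb K L => simp only [mulA_box_box, mulA_tens_box, mul_assoc, map_smul]
  | hb U W =>
    induction y using A_induction with
    | ha x x' hx hx' => simp only [map_add, LinearMap.add_apply, hx, hx']
    | ht P Q =>
      induction z using A_induction with
      | ha x x' hx hx' => simp only [map_add, hx, hx']
      | ht K L => simp only [mulA_tens_tens, mulA_box_tens, mul_assoc]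
      | hb K L =>
        simp only [mulA_box_tens, mulA_tens_box, mulA_box_box, mul_assoc]
        rw [Tr_mul_comm]
        simp only [mul_assoc]
    | hb P Q =>
      induction z using A_induction with
      | ha x x' hx hx' => simp only [map_add, hx, hx']
      | ht K L => simp only [mulA_box_tens, mulA_box_box, mul_assoc, map_smul, LinearMap.smul_apply]
      | hb K L =>
        simp only [mulA_box_box, map_smul, LinearMap.smul_apply, smul_smul]
        rw [mul_comm]

theorem mulA_one (N : ℕ) (x : A n) :
    mulA N (tens 1 1) x = x ∧ mulA N x (tens 1 1) = x := by
  induction x using A_induction with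
  | ha x y hx hy =>
    simp only [map_add, LinearMap.add_apply, hx, hy, and_self]
  | ht U W => simp [mulA_tens_tens]
  | hb U W => simp [mulA_box_tens, mulA_tens_box]

/-! ### The matrix algebra over `𝒜` -/

/-- The product of the matrix algebra over `𝒜`. -/
def mulMA (N : ℕ) : MA n →ₗ[TraceRing n] MA n →ₗ[TraceRing n] MA n :=
  LinearMap.mk₂ (TraceRing n)
    (fun F G => Matrix.of fun a c => ∑ b, mulA N (F a b) (G b c))
    (fun F F' G => by
      ext1 a c
      simp only [Matrix.of_apply, Matrix.add_apply, map_add, LinearMap.add_apply,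
        Finset.sum_add_distrib])
    (fun r F G => by
      ext1 a c
      simp only [Matrix.of_apply, Matrix.smul_apply, map_smul, LinearMap.smul_apply,
        Finset.smul_sum])
    (fun F G G' => by
      ext1 a c
      simp only [Matrix.of_apply, Matrix.add_apply, map_add, Finset.sum_add_distrib])
    (fun r F G => by
      ext1 a c
      simp only [Matrix.of_apply, Matrix.smul_apply, map_smul, Finset.smul_sum])

theorem mulMA_apply (N : ℕ) (F G : MA n) (a c : Fin n) :
    mulMA N F G a c = ∑ b, mulA N (F a b) (G b c) := rfl

/-- The trace of the matrix algebra over `𝒜`. -/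
def trMA (N : ℕ) : MA n →ₗ[TraceRing n] TraceRing n :=
  trA N ∘ₗ Matrix.traceLinearMap (Fin n) (TraceRing n) (A n)

theorem trMA_apply (N : ℕ) (F : MA n) : trMA N F = ∑ a, trA N (F a a) := by
  simp [trMA, Matrix.trace]

theorem mulMA_single_of_ne (N : ℕ) {a b c d : Fin n} (h : b ≠ c) (x y : A n) :
    mulMA N (Matrix.single a b x) (Matrix.single c d y) = 0 := by
  ext1 i j
  rw [mulMA_apply]
  refine Finset.sum_eq_zero fun e _ => ?_
  by_cases hb : b = e
  · subst hb
    rw [Matrix.single_apply_of_row_ne h.symm, map_zero]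
  · rw [Matrix.single_apply_of_col_ne _ _ hb, map_zero, LinearMap.zero_apply]

theorem mulMA_single_same (N : ℕ) (a b d : Fin n) (x y : A n) :
    mulMA N (Matrix.single a b x) (Matrix.single b d y) = Matrix.single a d (mulA N x y) := by
  ext1 i j
  rw [mulMA_apply, Finset.sum_eq_single b]
  · simp only [Matrix.single_apply]
    by_cases hi : a = i <;> by_cases hj : d = j <;> simp [hi, hj]
  · intro e _ he
    rw [Matrix.single_apply_of_col_ne _ _ he.symm, map_zero, LinearMap.zero_apply]
  · simp

theorem trMA_single (N : ℕ) (a b : Fin n) (x : A n) :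
    trMA N (Matrix.single a b x) = if a = b then trA N x else 0 := by
  rw [trMA_apply, Finset.sum_eq_single a]
  · by_cases h : a = b <;> simp [Matrix.single_apply, h]
    simp [Ne.symm h]
  · intro e _ he
    rw [Matrix.single_apply_of_row_ne he.symm, map_zero]
  · simp

/-! ### Products over the cycles of a permutation -/

section Cycles

variable {H H' : Type}

/-- The word read along the first `j` steps of the orbit of `h`. -/
def pathWord (σ : Equiv.Perm H) (leg : H → Word n) (h : H) (j : ℕ) : Word n :=
  ((List.range j).map fun i => leg ((σ ^ i) h)).flatten

/-- The word read along the cycle through `h`. -/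
def cycleWord (σ : Equiv.Perm H) (leg : H → Word n) (h : H) : Word n :=
  pathWord σ leg h (Function.minimalPeriod σ h)

theorem pathWord_zero (σ : Equiv.Perm H) (leg : H → Word n) (h : H) : pathWord σ leg h 0 = [] := rfl

theorem pathWord_one (σ : Equiv.Perm H) (leg : H → Word n) (h : H) :
    pathWord σ leg h 1 = leg h := by
  simp [pathWord]

theorem pathWord_add (σ : Equiv.Perm H) (leg : H → Word n) (h : H) (i j : ℕ) :
    pathWord σ leg h (i + j) = pathWord σ leg h i ++ pathWord σ leg ((σ ^ i) h) j := by
  simp only [pathWord, List.range_add, List.map_append, List.flatten_append, List.map_map]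
  congr 3
  funext k
  simp [← Equiv.Perm.mul_apply, ← pow_add, add_comm]

theorem pathWord_succ (σ : Equiv.Perm H) (leg : H → Word n) (h : H) (j : ℕ) :
    pathWord σ leg h (j + 1) = leg h ++ pathWord σ leg (σ h) j := by
  rw [add_comm, pathWord_add, pathWord_one, pow_one]

theorem perm_pow_minimalPeriod (σ : Equiv.Perm H) (h : H) :
    (σ ^ Function.minimalPeriod σ h) h = h := by
  have := Function.isPeriodicPt_minimalPeriod σ h
  rwa [Function.IsPeriodicPt, Function.IsFixedPt, ← Equiv.Perm.coe_pow] at this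

variable [Finite H] [Finite H']

theorem minimalPeriod_perm_pos (σ : Equiv.Perm H) (h : H) : 0 < Function.minimalPeriod σ h :=
  Function.minimalPeriod_pos_of_mem_periodicPts (σ.injective.mem_periodicPts h)

theorem trWord_cycleWord_apply (N : ℕ) (σ : Equiv.Perm H) (leg : H → Word n) (h : H) :
    trWord N (cycleWord σ leg (σ h)) = trWord N (cycleWord σ leg h) := by
  have hp : Function.minimalPeriod σ (σ h) = Function.minimalPeriod σ h :=
    Function.minimalPeriod_apply (σ.injective.mem_periodicPts h)
  unfold cycleWord
  rw [hp]
  obtain ⟨p, hp'⟩ := Nat.exists_eq_succ_of_ne_zero (minimalPeriod_perm_pos σ h).ne'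
  have hper := perm_pow_minimalPeriod σ h
  rw [hp', Nat.succ_eq_add_one] at *
  rw [pathWord_succ σ leg h, pathWord_add, pathWord_one, trWord_append_comm]
  rw [pow_succ, Equiv.Perm.mul_apply] at hper
  rw [hper]

theorem trWord_cycleWord_of_sameCycle (N : ℕ) (σ : Equiv.Perm H) (leg : H → Word n) {h h' : H}
    (hh : σ.SameCycle h h') : trWord N (cycleWord σ leg h) = trWord N (cycleWord σ leg h') := by
  obtain ⟨i, rfl⟩ := hh.exists_nat_pow_eq
  induction i with
  | zero => rfl
  | succ i ih => rw [pow_succ', Equiv.Perm.mul_apply, trWord_cycleWord_apply, ih ⟨i, rfl⟩]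

/-- The traces of the words along the cycles, as a function on the set of cycles. -/
def cycleTr (N : ℕ) (σ : Equiv.Perm H) (leg : H → Word n) :
    Quotient (Equiv.Perm.SameCycle.setoid σ) → TraceRing n :=
  Quotient.lift (fun h => trWord N (cycleWord σ leg h))
    fun _ _ hh => trWord_cycleWord_of_sameCycle N σ leg hh

open Classical in
/-- The product over all cycles of the traces of the words along them. -/
def cycleProd (N : ℕ) [Fintype H] (σ : Equiv.Perm H) (leg : H → Word n) : TraceRing n :=
  ∏ f, cycleTr N σ leg f

/-- `τ` is the first return map of `σ` to the subset `H'` embedded by `ι`, with return times `r`,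
and the legs of `H'` are the words read until the return. -/
structure IsFirstReturn (σ : Equiv.Perm H) (leg : H → Word n) (τ : Equiv.Perm H')
    (leg' : H' → Word n) (ι : H' → H) (r : H' → ℕ) : Prop where
  inj : Function.Injective ι
  pos : ∀ a, 0 < r a
  ret : ∀ a, (σ ^ r a) (ι a) = ι (τ a)
  first : ∀ a i, 0 < i → i < r a → ∀ b, (σ ^ i) (ι a) ≠ ι b
  legs : ∀ a, leg' a = pathWord σ leg (ι a) (r a)

/-- The time of the `j`-th return. -/
def returnTime (τ : Equiv.Perm H') (r : H' → ℕ) : ℕ → H' → ℕ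
  | 0, _ => 0
  | j + 1, a => r a + returnTime τ r j (τ a)

namespace IsFirstReturn

variable {σ : Equiv.Perm H} {leg : H → Word n} {τ : Equiv.Perm H'} {leg' : H' → Word n}
  {ι : H' → H} {r : H' → ℕ}

omit [Finite H] [Finite H'] in
theorem pow_returnTime (hf : IsFirstReturn σ leg τ leg' ι r) (j : ℕ) (a : H') :
    (σ ^ returnTime τ r j a) (ι a) = ι ((τ ^ j) a) := by
  induction j generalizing a with
  | zero => rfl
  | succ j ih =>
    rw [returnTime, add_comm, pow_add, Equiv.Perm.mul_apply, hf.ret, ih, pow_succ,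
      Equiv.Perm.mul_apply]

omit [Finite H] [Finite H'] in
theorem pathWord_returnTime (hf : IsFirstReturn σ leg τ leg' ι r) (j : ℕ) (a : H') :
    pathWord σ leg (ι a) (returnTime τ r j a) = pathWord τ leg' a j := by
  induction j generalizing a with
  | zero => rfl
  | succ j ih => rw [returnTime, pathWord_add, hf.ret, ih, pathWord_succ, hf.legs]

omit [Finite H] [Finite H'] in
theorem exists_returnTime (hf : IsFirstReturn σ leg τ leg' ι r) (p : ℕ) (a b : H')
    (h : (σ ^ p) (ι a) = ι b) : ∃ j, p = returnTime τ r j a ∧ (τ ^ j) a = b := by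
  induction p using Nat.strong_induction_on generalizing a with
  | _ p ih =>
    rcases Nat.eq_zero_or_pos p with rfl | hp
    · exact ⟨0, rfl, hf.inj h⟩
    · rcases lt_or_ge p (r a) with hlt | hge
      · exact absurd h (hf.first a p hp hlt b)
      · obtain ⟨q, rfl⟩ := Nat.exists_eq_add_of_le hge
        rw [add_comm, pow_add, Equiv.Perm.mul_apply, hf.ret] at h
        have := hf.pos a
        obtain ⟨j, rfl, hj⟩ := ih q (by omega) (τ a) h
        exact ⟨j + 1, rfl, by rw [pow_succ, Equiv.Perm.mul_apply, hj]⟩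

omit [Finite H'] in
theorem returnTime_add (i j : ℕ) (a : H') :
    returnTime τ r (i + j) a = returnTime τ r i a + returnTime τ r j ((τ ^ i) a) := by
  induction i generalizing a with
  | zero => simp [returnTime]
  | succ i ih =>
    rw [Nat.add_right_comm, returnTime, ih, returnTime, pow_succ, Equiv.Perm.mul_apply, add_assoc]

theorem minimalPeriod_eq (hf : IsFirstReturn σ leg τ leg' ι r) (a : H') :
    Function.minimalPeriod σ (ι a) = returnTime τ r (Function.minimalPeriod τ a) a := by
  obtain ⟨j, hp, hj⟩ := hf.exists_returnTime _ a a (perm_pow_minimalPeriod σ (ι a))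
  have hσ := minimalPeriod_perm_pos σ (ι a)
  have hτ := minimalPeriod_perm_pos τ a
  refine le_antisymm ?_ ?_
  · apply Function.IsPeriodicPt.minimalPeriod_le
    · obtain ⟨q, hq⟩ := Nat.exists_eq_succ_of_ne_zero hτ.ne'
      rw [hq, Nat.succ_eq_add_one, returnTime]
      have := hf.pos a
      omega
    · rw [Function.IsPeriodicPt, Function.IsFixedPt, ← Equiv.Perm.coe_pow, hf.pow_returnTime,
        perm_pow_minimalPeriod]
  · have hj0 : 0 < j := by
      rcases Nat.eq_zero_or_pos j with rfl | h
      · rw [hp, returnTime] at hσ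
        omega
      · exact h
    have hle : Function.minimalPeriod τ a ≤ j := by
      apply Function.IsPeriodicPt.minimalPeriod_le hj0
      rwa [Function.IsPeriodicPt, Function.IsFixedPt, ← Equiv.Perm.coe_pow]
    obtain ⟨q, hq⟩ := Nat.exists_eq_add_of_le hle
    rw [hp]
    conv_rhs => rw [hq, returnTime_add]
    exact Nat.le_add_right _ _

theorem cycleWord_eq (hf : IsFirstReturn σ leg τ leg' ι r) (a : H') :
    cycleWord σ leg (ι a) = cycleWord τ leg' a := by
  rw [cycleWord, hf.minimalPeriod_eq, hf.pathWord_returnTime, cycleWord]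

theorem sameCycle_iff (hf : IsFirstReturn σ leg τ leg' ι r) (a b : H') :
    σ.SameCycle (ι a) (ι b) ↔ τ.SameCycle a b := by
  constructor
  · intro h
    obtain ⟨p, hp⟩ := h.exists_nat_pow_eq
    obtain ⟨j, -, hj⟩ := hf.exists_returnTime p a b hp
    exact ⟨j, by simpa using hj⟩
  · intro h
    obtain ⟨j, rfl⟩ := h.exists_nat_pow_eq
    exact ⟨returnTime τ r j a, by simpa using hf.pow_returnTime j a⟩

/-- The map induced on cycles. -/
def cycleMap (hf : IsFirstReturn σ leg τ leg' ι r) :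
    Quotient (Equiv.Perm.SameCycle.setoid τ) → Quotient (Equiv.Perm.SameCycle.setoid σ) :=
  Quotient.map ι fun a b h => (hf.sameCycle_iff a b).2 h

theorem cycleMap_injective (hf : IsFirstReturn σ leg τ leg' ι r) :
    Function.Injective hf.cycleMap := by
  intro x y
  induction x using Quotient.inductionOn
  induction y using Quotient.inductionOn
  intro h
  exact Quotient.sound ((hf.sameCycle_iff _ _).1 (Quotient.exact h))

theorem cycleTr_cycleMap (N : ℕ) (hf : IsFirstReturn σ leg τ leg' ι r)
    (x : Quotient (Equiv.Perm.SameCycle.setoid τ)) :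
    cycleTr N σ leg (hf.cycleMap x) = cycleTr N τ leg' x := by
  induction x using Quotient.inductionOn with
  | _ a => exact congrArg (trWord N) (hf.cycleWord_eq a)

theorem cycleProd_eq [Fintype H] [Fintype H'] (N : ℕ) (hf : IsFirstReturn σ leg τ leg' ι r)
    (hs : ∀ h, ∃ a, σ.SameCycle (ι a) h) : cycleProd N σ leg = cycleProd N τ leg' := by
  classical
  unfold cycleProd
  refine (Fintype.prod_bijective hf.cycleMap ⟨hf.cycleMap_injective, ?_⟩ _ _
    fun x => (hf.cycleTr_cycleMap N x).symm).symm
  intro y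
  induction y using Quotient.inductionOn with
  | _ h =>
    obtain ⟨a, ha⟩ := hs h
    exact ⟨Quotient.mk _ a, Quotient.sound ha⟩

theorem cycleProd_eq_mul [Fintype H] [Fintype H'] (N : ℕ) (hf : IsFirstReturn σ leg τ leg' ι r)
    (h₀ : H) (hn : ∀ a, ¬ σ.SameCycle (ι a) h₀)
    (hs : ∀ h, σ.SameCycle h₀ h ∨ ∃ a, σ.SameCycle (ι a) h) :
    cycleProd N σ leg = trWord N (cycleWord σ leg h₀) * cycleProd N τ leg' := by
  classical
  unfold cycleProd
  let e : Option (Quotient (Equiv.Perm.SameCycle.setoid τ)) →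
      Quotient (Equiv.Perm.SameCycle.setoid σ) :=
    fun o => o.elim (Quotient.mk _ h₀) hf.cycleMap
  have hne : ∀ x, hf.cycleMap x ≠ Quotient.mk _ h₀ := by
    intro x
    induction x using Quotient.inductionOn with
    | _ a => exact fun h => hn a (Quotient.exact h)
  have he : Function.Bijective e := by
    constructor
    · rintro (_ | x) (_ | y) h
      · rfl
      · exact absurd h.symm (hne y)
      · exact absurd h (hne x)
      · exact congrArg some (hf.cycleMap_injective h)
    · intro y
      induction y using Quotient.inductionOn with
      | _ h =>
        rcases hs h with h' | ⟨a, ha⟩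
        · exact ⟨none, Quotient.sound h'⟩
        · exact ⟨some (Quotient.mk _ a), Quotient.sound ha⟩
  rw [← Fintype.prod_bijective e he (fun o => cycleTr N σ leg (e o)) _ fun _ => rfl,
    Fintype.prod_option]
  congr 1
  exact Finset.prod_congr rfl fun x _ => hf.cycleTr_cycleMap N x

end IsFirstReturn

end Cycles

theorem effVertex_eq (N : ℕ) (G : RibbonGraph n) :
    G.effVertex N = cycleProd N G.face G.leg * ∏ v, trProd N (G.spect v) := by
  unfold RibbonGraph.effVertex cycleProd
  congr 1
  refine Finset.prod_congr rfl fun f _ => ?_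
  conv_rhs => rw [← Quotient.out_eq f]
  rfl

/-! ### Loop graphs are one-loop graphs -/

section OneLoop

variable {k : ℕ} (m : Fin (k + 1) → MarkedVertex n) (hm : Closes m)

theorem loopProp_true (i : Fin (k + 1)) : loopProp k (i, true) = (i + 1, false) := rfl

theorem loopProp_loopProp (h : Fin (k + 1) × Bool) : loopProp k (loopProp k h) = h := by
  rcases h with ⟨i, _ | _⟩ <;> simp [loopProp]

theorem loopGraph_link_symm {S : Set (Fin (k + 1) × Bool)} (hS : ∀ h, h ∉ S → loopProp k h ∉ S)
    (u v : Fin (k + 1)) (h : (loopGraph m hm).Link S u v) : (loopGraph m hm).Link S v u := by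
  obtain ⟨h, hh, rfl, rfl⟩ := h
  refine ⟨loopProp k h, hS h hh, rfl, ?_⟩
  exact congrArg Prod.fst (loopProp_loopProp (k := k) h)

theorem ofNat_succ (k l : ℕ) : Fin.ofNat (k + 1) (l + 1) = Fin.ofNat (k + 1) l + 1 := by
  ext; simp [Fin.val_add, Fin.ofNat]

theorem loopGraph_connectedWithout (j : Fin (k + 1)) {S : Set (Fin (k + 1) × Bool)}
    (hS : ∀ h, h ∉ S → loopProp k h ∉ S) (hj : ∀ i, (i, true) ∈ S → i = j) :
    (loopGraph m hm).ConnectedWithout S := by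
  refine ⟨⟨(0 : Fin (k + 1))⟩, ?_⟩
  have step : ∀ l : ℕ, l ≤ k → Relation.ReflTransGen ((loopGraph m hm).Link S)
      (j + 1 : Fin (k + 1)) (j + 1 + (Fin.ofNat (k + 1) l) : Fin (k + 1)) := by
    intro l
    induction l with
    | zero =>
      intro _
      have : (j + 1 + Fin.ofNat (k + 1) 0 : Fin (k + 1)) = j + 1 := by simp
      rw [this]
      exact Relation.ReflTransGen.refl
    | succ l ih =>
      intro hl
      refine (ih (by omega)).tail ⟨((j + 1 + Fin.ofNat (k + 1) l : Fin (k + 1)), true), ?_, rfl, ?_⟩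
      · intro hmem
        have h1 := hj _ hmem
        have h2 : (1 + Fin.ofNat (k + 1) l : Fin (k + 1)) = 0 := by
          simpa [add_assoc] using h1
        have h3 : (Fin.ofNat (k + 1) (l + 1) : Fin (k + 1)) = 0 :=
          (ofNat_succ k l).trans ((add_comm _ _).trans h2)
        have h4 := congrArg Fin.val h3
        simp only [Fin.ofNat, Fin.val_zero] at h4
        rw [Nat.mod_eq_of_lt (by omega)] at h4
        omega
      · change (j + 1 + Fin.ofNat (k + 1) l + 1 : Fin (k + 1)) = j + 1 + Fin.ofNat (k + 1) (l + 1)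
        rw [ofNat_succ, add_assoc _ _ (1 : Fin (k + 1))]
  have reach : ∀ v : Fin (k + 1), Relation.ReflTransGen ((loopGraph m hm).Link S)
      (j + 1 : Fin (k + 1)) v := by
    intro v
    have h := step (v - (j + 1)).val (by omega)
    have : (j + 1 + Fin.ofNat (k + 1) (v - (j + 1)).val : Fin (k + 1)) = v := by
      simp
    rwa [this] at h
  have symm : Std.Symm ((loopGraph m hm).Link S) := ⟨loopGraph_link_symm m hm hS⟩
  exact fun u v => (Std.Symm.symm _ _ (reach u)).trans (reach v)

theorem loopGraph_isOnePI : (loopGraph m hm).IsOnePI := by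
  refine ⟨loopGraph_connectedWithout m hm 0 (fun h _ => Set.notMem_empty (loopProp k h))
    fun i hi => absurd hi (Set.notMem_empty (i, true)), fun h => ?_⟩
  let h' : Fin (k + 1) × Bool := h
  have hS : ∀ x : Fin (k + 1) × Bool, x ∉ ({h', loopProp k h'} : Set (Fin (k + 1) × Bool)) →
      loopProp k x ∉ ({h', loopProp k h'} : Set (Fin (k + 1) × Bool)) := by
    intro x hx hx'
    apply hx
    rcases hx' with hx' | hx'
    · right
      rw [Set.mem_singleton_iff, ← hx', loopProp_loopProp]
    · left
      exact (loopProp k).injective hx'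
  refine loopGraph_connectedWithout m hm (if h'.2 then h'.1 else h'.1 - 1) hS fun i hi => ?_
  replace hi : (i, true) = h' ∨ (i, true) = loopProp k h' := hi
  generalize h' = x at hi
  rcases x with ⟨j, _ | _⟩
  · simpa [loopProp] using hi
  · simpa [loopProp] using hi

theorem card_loopProp_cycles :
    Nat.card (Quotient (Equiv.Perm.SameCycle.setoid (loopProp k))) = k + 1 := by
  let q : Fin (k + 1) × Bool → Fin (k + 1) := fun h => if h.2 then h.1 else h.1 - 1
  have hq : ∀ h, q (loopProp k h) = q h := by
    rintro ⟨i, _ | _⟩ <;> simp [q, loopProp]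
  have hq' : ∀ h h', (loopProp k).SameCycle h h' → q h = q h' := by
    intro h h' hh
    obtain ⟨p, rfl⟩ := hh.exists_nat_pow_eq
    clear hh
    induction p with
    | zero => rfl
    | succ p ih => rw [pow_succ', Equiv.Perm.mul_apply, hq, ih]
  have hb : Function.Bijective (Quotient.lift q hq' :
      Quotient (Equiv.Perm.SameCycle.setoid (loopProp k)) → Fin (k + 1)) := by
    constructor
    · intro x y
      induction x using Quotient.inductionOn with | _ x => ?_
      induction y using Quotient.inductionOn with | _ y => ?_
      intro h
      change q x = q y at h
      have hc : ∀ z, (loopProp k).SameCycle z (q z, true) := by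
        rintro ⟨i, _ | _⟩
        · exact ⟨1, by simp [q, loopProp]⟩
        · exact ⟨0, by simp [q]⟩
      exact Quotient.sound ((hc x).trans (h ▸ (hc y).symm))
    · intro i
      exact ⟨Quotient.mk _ (i, true), by simp [q]⟩
  rw [Nat.card_congr (Equiv.ofBijective _ hb), Nat.card_fin]

theorem loopGraph_isOneLoop : (loopGraph m hm).IsOneLoop := by
  have h1 := loopGraph_isOnePI m hm
  refine ⟨h1, ?_⟩
  have hE : Nat.card (Quotient (Equiv.Perm.SameCycle.setoid (loopGraph m hm).prop)) = k + 1 :=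
    card_loopProp_cycles
  have hV : Nat.card (loopGraph m hm).V = k + 1 := Nat.card_fin (k + 1)
  have hC : Nat.card (Quot ((loopGraph m hm).Link ∅)) = 1 := by
    rw [Nat.card_eq_one_iff_unique]
    refine ⟨⟨fun x y => ?_⟩, ⟨Quot.mk _ (0 : Fin (k + 1))⟩⟩
    induction x using Quot.ind with | _ u => ?_
    induction y using Quot.ind with | _ v => ?_
    rw [Quot.eq]
    have h := h1.1.2 u v
    induction h with
    | refl => exact Relation.EqvGen.refl _
    | tail _ hl ih => exact ih.trans _ _ _ (Relation.EqvGen.rel _ _ hl)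
  rw [RibbonGraph.betti, hE, hV, hC]
  simp

open Classical in
theorem loopContribution_eq (N : ℕ) : loopContribution N m =
    if hm : Closes m then (loopGraph m hm).effVertex N else 0 := by
  unfold loopContribution
  split_ifs with h h'
  · rfl
  · exact absurd (loopGraph_isOneLoop m h) h'
  · rfl

end OneLoop

/-! ### Contracting the first propagator of a loop graph -/

/-- The marked vertex obtained by contracting the propagator between the second half-edge of `m`
and the first half-edge of `m'`. -/
def MarkedVertex.comp (m m' : MarkedVertex n) : MarkedVertex n where
  a := m.a
  b := m'.b
  x := match m.split, m'.split with
    | false, false => m'.x ++ m.x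
    | false, true => m.y ++ m'.x ++ m.x
    | true, _ => m.x
  y := match m.split, m'.split with
    | false, false => m.y ++ m'.y
    | true, false => m'.x ++ m.y ++ m'.y
    | _, true => m'.y
  split := m.split || m'.split
  spect := (if m.split && m'.split then [m.y ++ m'.x] else []) ++ (m.spect ++ m'.spect)

theorem trProd_append (N : ℕ) (l l' : List (Word n)) :
    trProd N (l ++ l') = trProd N l * trProd N l' := by
  simp [trProd]

theorem mulMA_entry (N : ℕ) (m m' : MarkedVertex n) :
    mulMA N (m.entry N) (m'.entry N) = if m.b = m'.a then (m.comp m').entry N else 0 := by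
  rcases m with ⟨a, b, x, y, s, l⟩
  rcases m' with ⟨a', b', x', y', s', l'⟩
  by_cases h : b = a'
  · subst h
    rw [if_pos rfl]
    unfold MarkedVertex.entry
    rw [mulMA_single_same]
    congr 1
    cases s <;> cases s' <;>
      simp [MarkedVertex.comp, mulA_tens_tens, mulA_tens_box, mulA_box_tens, mulA_box_box,
        mono_mul, smul_smul, mul_comm, Tr_mono, trProd]
    ring_nf
  · rw [if_neg h]
    exact mulMA_single_of_ne N h _ _

/-- The sequence of marked vertices in which the first two have been contracted. -/
def contractFirst {α : Type*} {k : ℕ} (op : α → α → α) (f : Fin (k + 2) → α) : Fin (k + 1) → α :=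
  Fin.cons (op (f 0) (f 1)) fun i => f i.succ.succ

theorem contractFirst_zero {α : Type*} {k : ℕ} (op : α → α → α) (f : Fin (k + 2) → α) :
    contractFirst op f 0 = op (f 0) (f 1) := rfl

theorem contractFirst_of_ne {α : Type*} {k : ℕ} (op : α → α → α) (f : Fin (k + 2) → α)
    {i : Fin (k + 1)} (hi : i ≠ 0) : contractFirst op f i = f i.succ := by
  obtain ⟨j, rfl⟩ := Fin.exists_succ_eq.2 hi
  rfl

theorem starProd_contractFirst (star : MA n →ₗ[TraceRing n] MA n →ₗ[TraceRing n] MA n) (k : ℕ)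
    (f : Fin (k + 2) → MA n) :
    starProd star (k + 1) f = starProd star k (contractFirst (fun x y => star x y) f) := by
  induction k with
  | zero => rfl
  | succ k ih =>
    rw [starProd, ih]
    conv_rhs => rw [starProd]
    congr 2
    congr 1
    funext i
    induction i using Fin.cases <;> rfl

section Contract

variable {k : ℕ} (m : Fin (k + 2) → MarkedVertex n)

theorem succ_add_one (i : Fin (k + 1)) :
    i.succ + 1 = if i + 1 = 0 then 0 else (i + 1).succ := by
  induction i using Fin.lastCases with
  | last => simp
  | cast i =>
    rw [if_neg]
    · rw [Fin.succ_castSucc, Fin.coeSucc_eq_succ, Fin.coeSucc_eq_succ]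
    · rw [Fin.coeSucc_eq_succ]; exact Fin.succ_ne_zero i

theorem closes_iff_contractFirst : Closes m ↔
    (m 0).b = (m 1).a ∧ Closes (contractFirst MarkedVertex.comp m) := by
  have hb : ∀ i, (contractFirst MarkedVertex.comp m i).b = (m i.succ).b := by
    intro i
    induction i using Fin.cases <;> rfl
  have ha : ∀ i, (contractFirst MarkedVertex.comp m (i + 1)).a = (m (i.succ + 1)).a := by
    intro i
    rw [succ_add_one]
    by_cases h : i + 1 = 0
    · rw [h, if_pos rfl]; rfl
    · rw [if_neg h, contractFirst_of_ne _ _ h]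
  unfold Closes
  simp only [ha, hb]
  rw [Fin.forall_fin_succ]
  simp

/-- The half-edges that are left after the contraction. -/
def contractEmb (h : Fin (k + 1) × Bool) : Fin (k + 2) × Bool :=
  if h = (0, false) then (0, false) else (h.1.succ, h.2)

theorem contractEmb_injective : Function.Injective (contractEmb (k := k)) := by
  intro h h' e
  unfold contractEmb at e
  split_ifs at e with h1 h2 h2
  · rw [h1, h2]
  · exact absurd (congrArg Prod.fst e).symm (Fin.succ_ne_zero _)
  · exact absurd (congrArg Prod.fst e) (Fin.succ_ne_zero _)
  · simp only [Prod.mk.injEq, Fin.succ_inj] at e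
    exact Prod.ext e.1 e.2

theorem contractEmb_zero_false : contractEmb (k := k) (0, false) = (0, false) := rfl

theorem contractEmb_true (i : Fin (k + 1)) : contractEmb (i, true) = (i.succ, true) := by
  simp [contractEmb]

theorem contractEmb_of_ne {i : Fin (k + 1)} (hi : i ≠ 0) (β : Bool) :
    contractEmb (i, β) = (i.succ, β) := by
  simp [contractEmb, hi]

theorem contractEmb_ne_zero_true (h : Fin (k + 1) × Bool) : contractEmb h ≠ (0, true) := by
  unfold contractEmb
  split_ifs
  · simp
  · exact fun e => Fin.succ_ne_zero _ (congrArg Prod.fst e)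

theorem contractEmb_ne_one_false (h : Fin (k + 1) × Bool) : contractEmb h ≠ (1, false) := by
  unfold contractEmb
  split_ifs with h1
  · simp
  · intro e
    apply h1
    rw [Prod.mk.injEq, ← Fin.succ_zero_eq_one, Fin.succ_inj] at e
    exact Prod.ext e.1 e.2

theorem contractEmb_loopProp (h : Fin (k + 1) × Bool) :
    contractEmb (loopProp k h) = loopProp (k + 1) (contractEmb h) := by
  have key : ∀ i : Fin (k + 1), contractEmb (loopProp k (i, true)) =
      loopProp (k + 1) (contractEmb (i, true)) := by
    intro i
    rw [contractEmb_true, loopProp_true, loopProp_true, succ_add_one]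
    by_cases h : i + 1 = 0
    · rw [if_pos h, h, contractEmb_zero_false]
    · rw [if_neg h, contractEmb_of_ne h]
  rcases h with ⟨i, _ | _⟩
  · have h1 : (i, false) = loopProp k (i - 1, true) := by simp [loopProp]
    rw [h1, loopProp_loopProp, key, loopProp_loopProp]
  · exact key i

/-- The permutation `face` of a loop graph. -/
def loopFace (m : Fin (k + 1) → MarkedVertex n) : Equiv.Perm (Fin (k + 1) × Bool) :=
  (loopNext m).trans (loopProp k)

/-- The legs of a loop graph. -/
def loopLeg (m : Fin (k + 1) → MarkedVertex n) (h : Fin (k + 1) × Bool) : Word n :=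
  if (m h.1).split = h.2 then (m h.1).y else (m h.1).x

theorem loopFace_apply (m : Fin (k + 1) → MarkedVertex n) (h : Fin (k + 1) × Bool) :
    loopFace m h = loopProp k (if (m h.1).split then h else (h.1, !h.2)) := rfl

theorem loopProp_zero_true : loopProp (k + 1) (0, true) = (1, false) := rfl

theorem loopProp_one_false : loopProp (k + 1) (1, false) = (0, true) := by
  simp [loopProp]

/-- The number of half-edges read until the next half-edge left by the contraction. -/
def contractTime (h : Fin (k + 1) × Bool) : ℕ :=
  if h.1 = 0 then
    match (m 0).split, (m 1).split, h.2 with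
    | false, false, _ => 2
    | false, true, false => 3
    | false, true, true => 1
    | true, false, false => 1
    | true, false, true => 3
    | true, true, _ => 1
  else 1

theorem isFirstReturn_contract : IsFirstReturn (loopFace m) (loopLeg m)
    (loopFace (contractFirst MarkedVertex.comp m)) (loopLeg (contractFirst MarkedVertex.comp m))
    contractEmb (contractTime m) := by
  have h01 : contractEmb (k := k) (0, false) = (0, false) := rfl
  have h11 : contractEmb (k := k) (0, true) = (1, true) := rfl
  have hP := loopProp_zero_true (k := k)
  have hP' := loopProp_one_false (k := k)
  have hQ : contractEmb (loopProp k (0, false)) = loopProp (k + 1) (0, false) :=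
    contractEmb_loopProp (0, false)
  have hQ' : contractEmb (loopProp k (0, true)) = loopProp (k + 1) (1, true) :=
    contractEmb_loopProp (0, true)
  refine ⟨contractEmb_injective, ?_, ?_, ?_, ?_⟩
  · intro h
    unfold contractTime
    split_ifs
    · split <;> norm_num
    · norm_num
  · rintro ⟨i, β⟩
    by_cases hi : i = 0
    · subst hi
      cases h0 : (m 0).split <;> cases h1 : (m 1).split <;> cases β <;>
        simp [contractTime, h0, h1, h01, h11, loopFace_apply, contractFirst_zero,
          MarkedVertex.comp, hP, hP', hQ, hQ', pow_succ]
    · simp [contractTime, hi, loopFace_apply, contractFirst_of_ne _ _ hi, contractEmb_loopProp,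
        contractEmb_of_ne hi]
      split_ifs <;> simp [contractEmb_of_ne hi]
  · rintro ⟨i, β⟩ j hj hjr b e
    replace e := e.symm
    by_cases hi : i = 0
    · subst hi
      cases h0 : (m 0).split <;> cases h1 : (m 1).split <;> cases β <;>
        simp only [contractTime, h0, h1, if_true] at hjr <;> try omega
      all_goals
        interval_cases j <;>
          simp [h01, h11, loopFace_apply, h0, h1, hP, hP', pow_succ, contractEmb_ne_zero_true,
            contractEmb_ne_one_false] at e
    · simp only [contractTime, hi, if_false] at hjr
      omega
  · rintro ⟨i, β⟩
    by_cases hi : i = 0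
    · subst hi
      cases h0 : (m 0).split <;> cases h1 : (m 1).split <;> cases β <;>
        simp [contractTime, h0, h1, h01, h11, loopFace_apply, contractFirst_zero, loopLeg,
          MarkedVertex.comp, hP, hP', pathWord_succ, pathWord_zero]
    · simp [contractTime, hi, contractFirst_of_ne _ _ hi, loopLeg, contractEmb_of_ne hi,
        pathWord_one]

theorem not_sameCycle_of_closed {H : Type} [Finite H] {σ : Equiv.Perm H} {S : Set H}
    (hS : ∀ h ∈ S, σ h ∈ S) {h h' : H} (hh : h ∈ S) (hh' : h' ∉ S) : ¬ σ.SameCycle h h' := by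
  intro hc
  obtain ⟨p, rfl⟩ := hc.exists_nat_pow_eq
  clear hc
  apply hh'
  clear hh'
  induction p with
  | zero => exact hh
  | succ p ih => rw [pow_succ', Equiv.Perm.mul_apply]; exact hS _ ih

theorem eq_or_mem_range_contractEmb (h : Fin (k + 2) × Bool) :
    h = (0, true) ∨ h = (1, false) ∨ ∃ a, contractEmb a = h := by
  rcases h with ⟨i, β⟩
  induction i using Fin.cases with
  | zero =>
    cases β
    · exact Or.inr (Or.inr ⟨(0, false), rfl⟩)
    · exact Or.inl rfl
  | succ i =>
    cases β
    · by_cases hi : i = 0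
      · subst hi; exact Or.inr (Or.inl rfl)
      · exact Or.inr (Or.inr ⟨(i, false), contractEmb_of_ne hi _⟩)
    · exact Or.inr (Or.inr ⟨(i, true), contractEmb_true i⟩)

theorem cycleProd_contract (N : ℕ) : cycleProd N (loopFace m) (loopLeg m) =
    (if (m 0).split && (m 1).split then trWord N ((m 0).y ++ (m 1).x) else 1) *
      cycleProd N (loopFace (contractFirst MarkedVertex.comp m))
        (loopLeg (contractFirst MarkedVertex.comp m)) := by
  have hP := loopProp_zero_true (k := k)
  have hP' := loopProp_one_false (k := k)
  have hf := isFirstReturn_contract m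
  by_cases hs : (m 0).split = true ∧ (m 1).split = true
  · obtain ⟨h0, h1⟩ := hs
    have e0 : loopFace m (0, true) = (1, false) := by simp [loopFace_apply, h0, hP]
    have e1 : loopFace m (1, false) = (0, true) := by simp [loopFace_apply, h1, hP']
    rw [hf.cycleProd_eq_mul N (0, true)]
    · congr 1
      have hper : Function.minimalPeriod (loopFace m) (0, true) = 2 := by
        have : Fact (Nat.Prime 2) := ⟨Nat.prime_two⟩
        apply Function.minimalPeriod_eq_prime
        · simp [Function.IsPeriodicPt, Function.IsFixedPt, e0, e1]
        · simp [Function.IsFixedPt, e0]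
      rw [cycleWord, hper, pathWord_succ, pathWord_succ, e0, pathWord_zero]
      simp [loopLeg, h0, h1]
    · intro a hc
      refine not_sameCycle_of_closed (S := {(0, true), (1, false)}) ?_ (by simp) ?_ hc.symm
      · rintro h (rfl | rfl)
        · simp [e0]
        · simp [e1]
      · simp [contractEmb_ne_zero_true, contractEmb_ne_one_false]
    · intro h
      rcases eq_or_mem_range_contractEmb h with rfl | rfl | ⟨a, rfl⟩
      · exact Or.inl ⟨0, rfl⟩
      · exact Or.inl ⟨1, by simpa using e0⟩
      · exact Or.inr ⟨a, ⟨0, rfl⟩⟩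
  · rw [if_neg (by simpa using hs), one_mul]
    refine hf.cycleProd_eq N fun h => ?_
    rcases eq_or_mem_range_contractEmb h with rfl | rfl | ⟨a, rfl⟩
    · rcases h1 : (m 1).split with _ | _
      · exact ⟨(0, true), 1, by simp [contractEmb_true, loopFace_apply, h1, hP']⟩
      · have h0 : (m 0).split = false := by simpa [h1] using hs
        exact ⟨(0, false), 2, by
          simp [contractEmb_zero_false, loopFace_apply, h0, h1, hP, hP', pow_two]⟩
    · rcases h0 : (m 0).split with _ | _
      · exact ⟨(0, false), 1, by simp [contractEmb_zero_false, loopFace_apply, h0, hP]⟩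
      · have h1 : (m 1).split = false := by simpa [h0] using hs
        exact ⟨(0, true), 2, by
          simp [contractEmb_true, loopFace_apply, h0, h1, hP, hP', pow_two]⟩
    · exact ⟨a, 0, rfl⟩

end Contract

theorem loopGraph_effVertex (N : ℕ) {k : ℕ} (m : Fin (k + 1) → MarkedVertex n) (hm : Closes m) :
    (loopGraph m hm).effVertex N =
      cycleProd N (loopFace m) (loopLeg m) * ∏ i, trProd N (m i).spect :=
  effVertex_eq N _

theorem cycleProd_of_forall_sameCycle (N : ℕ) {H : Type} [Fintype H] (σ : Equiv.Perm H)
    (leg : H → Word n) (h₀ : H) (hs : ∀ h, σ.SameCycle h₀ h) :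
    cycleProd N σ leg = trWord N (cycleWord σ leg h₀) := by
  have hf : IsFirstReturn σ leg (1 : Equiv.Perm Empty) (fun _ => []) (fun e => e.elim)
      (fun e => e.elim) :=
    ⟨fun e => e.elim, fun e => e.elim, fun e => e.elim, fun e => e.elim, fun e => e.elim⟩
  rw [hf.cycleProd_eq_mul N h₀ (fun e => e.elim) fun h => Or.inl (hs h)]
  have : cycleProd N (1 : Equiv.Perm Empty) (fun _ => ([] : Word n)) = 1 := by
    classical
    unfold cycleProd
    have : IsEmpty (Quotient (Equiv.Perm.SameCycle.setoid (1 : Equiv.Perm Empty))) :=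
      ⟨fun q => Quotient.inductionOn q fun e => e.elim⟩
    exact Fintype.prod_empty _
  rw [this, mul_one]

theorem cycleProd_one_vertex (N : ℕ) (m : Fin 1 → MarkedVertex n) :
    cycleProd N (loopFace m) (loopLeg m) =
      if (m 0).split then trWord N ((m 0).x ++ (m 0).y)
      else trWord N (m 0).x * trWord N (m 0).y := by
  have hp : ∀ β, loopProp 0 (0, β) = (0, !β) := by decide
  cases hs : (m 0).split
  · have hF : loopFace m = 1 := by
      ext1 ⟨i, β⟩
      obtain rfl := Fin.fin_one_eq_zero i
      simp [loopFace_apply, hs, hp]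
    have hper : ∀ h, Function.minimalPeriod (loopFace m) h = 1 := by
      intro h
      rw [Function.minimalPeriod_eq_one_iff_isFixedPt, hF]
      rfl
    have hf : IsFirstReturn (loopFace m) (loopLeg m) (1 : Equiv.Perm Unit) (fun _ => (m 0).y)
        (fun _ => (0, false)) (fun _ => 1) := by
      refine ⟨fun _ _ _ => rfl, fun _ => one_pos, fun _ => by simp [hF], fun _ i _ _ => by omega,
        fun _ => ?_⟩
      rw [pathWord_one]
      simp [loopLeg, hs]
    rw [hf.cycleProd_eq_mul N (0, true), cycleProd_of_forall_sameCycle N _ _ ()]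
    · have hunit : Function.minimalPeriod (1 : Equiv.Perm Unit) () = 1 :=
        Function.minimalPeriod_eq_one_iff_isFixedPt.2 (Function.isFixedPt_id ())
      rw [cycleWord, cycleWord, hper, pathWord_one, hunit, pathWord_one]
      simp [loopLeg, hs]
    · exact fun _ => ⟨0, rfl⟩
    · rintro _ hc
      rw [hF, Equiv.Perm.sameCycle_one] at hc
      simp at hc
    · rintro ⟨i, β⟩
      obtain rfl := Fin.fin_one_eq_zero i
      cases β
      · exact Or.inr ⟨(), 0, rfl⟩
      · exact Or.inl ⟨0, rfl⟩
  · have hF : ∀ β, loopFace m (0, β) = (0, !β) := by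
      intro β
      simp [loopFace_apply, hs, hp]
    rw [cycleProd_of_forall_sameCycle N _ _ (0, false)]
    · have hper : Function.minimalPeriod (loopFace m) (0, false) = 2 := by
        have : Fact (Nat.Prime 2) := ⟨Nat.prime_two⟩
        apply Function.minimalPeriod_eq_prime
        · simp [Function.IsPeriodicPt, Function.IsFixedPt, hF]
        · simp [Function.IsFixedPt, hF]
      rw [cycleWord, hper, pathWord_succ, pathWord_succ, hF, pathWord_zero]
      simp [loopLeg, hs]
    · rintro ⟨i, β⟩
      obtain rfl := Fin.fin_one_eq_zero i
      cases β
      · exact ⟨0, rfl⟩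
      · exact ⟨1, by simp [hF]⟩

open Classical in
theorem trMA_starProd (N : ℕ) {k : ℕ} (m : Fin (k + 1) → MarkedVertex n) :
    trMA N (starProd (mulMA N) k fun i => (m i).entry N) = loopContribution N m := by
  rw [loopContribution_eq]
  simp only [loopGraph_effVertex]
  induction k with
  | zero =>
    rw [starProd, MarkedVertex.entry, trMA_single, cycleProd_one_vertex]
    have hc : Closes m ↔ (m 0).a = (m 0).b := by
      simp [Closes, Fin.forall_fin_one, eq_comm]
    by_cases h : (m 0).a = (m 0).b
    · rw [if_pos h, dif_pos (hc.2 h)]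
      cases (m 0).split <;> simp [trA_tens, trA_box, mono_mul, Tr_mono, mul_comm]
    · rw [if_neg h, dif_neg (mt hc.1 h)]
  | succ k ih =>
    rw [starProd_contractFirst]
    by_cases h : (m 0).b = (m 1).a
    · have hcf : contractFirst (fun x y => mulMA N x y) (fun i => (m i).entry N) =
          fun i => (contractFirst MarkedVertex.comp m i).entry N := by
        funext i
        induction i using Fin.cases with
        | zero =>
          change mulMA N ((m 0).entry N) ((m 1).entry N) = _
          rw [mulMA_entry, if_pos h]
          rfl
        | succ i => rfl
      rw [hcf, ih]
      by_cases hc : Closes m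
      · rw [dif_pos hc, dif_pos ((closes_iff_contractFirst m).1 hc).2, cycleProd_contract,
          Fin.prod_univ_succ, Fin.prod_univ_succ (fun i => trProd N (m i).spect),
          Fin.prod_univ_succ]
        have : trProd N (contractFirst MarkedVertex.comp m 0).spect =
            (if (m 0).split && (m 1).split then trWord N ((m 0).y ++ (m 1).x) else 1) *
              (trProd N (m 0).spect * trProd N (m 1).spect) := by
          rw [contractFirst_zero, MarkedVertex.comp, trProd_append, trProd_append]
          congr 1
          split_ifs <;> simp [trProd]
        rw [this]
        simp only [contractFirst, Fin.cons_succ, Fin.succ_zero_eq_one]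
        ring
      · rw [dif_neg hc, dif_neg fun h' => hc ((closes_iff_contractFirst m).2 ⟨h, h'⟩)]
    · have hz : ∀ (j : ℕ) (f : Fin (j + 1) → MA n), f 0 = 0 → starProd (mulMA N) j f = 0 := by
        intro j
        induction j with
        | zero => exact fun f hf => hf
        | succ j ihj => intro f hf; rw [starProd, ihj _ hf, map_zero, LinearMap.zero_apply]
      rw [hz, map_zero, dif_neg fun h' => h (h' 0)]
      change mulMA N ((m 0).entry N) ((m 1).entry N) = 0
      rw [mulMA_entry, if_neg h]

/-! ### Nondegeneracy of the trace form -/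

theorem trWord_ne_zero {N : ℕ} (hN : 0 < N) (w : Word n) : trWord N w ≠ 0 := by
  unfold trWord
  split_ifs
  · exact MvPolynomial.X_ne_zero _
  · simp [hN.ne']

theorem trProd_ne_zero {N : ℕ} (hN : 0 < N) (l : List (Word n)) : trProd N l ≠ 0 := by
  unfold trProd
  rw [Ne, List.prod_eq_zero_iff, List.mem_map]
  rintro ⟨w, -, hw⟩
  exact trWord_ne_zero hN w hw

theorem pderiv_trWord_of_ne (N : ℕ) (c : {c : Cycle (Fin n) // c ≠ Cycle.nil}) {w : Word n}
    (h : (w : Cycle (Fin n)) ≠ c.1) : MvPolynomial.pderiv c (trWord N w) = 0 := by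
  unfold trWord
  split_ifs with h'
  · exact MvPolynomial.pderiv_X_of_ne fun e => h (congrArg Subtype.val e)
  · exact MvPolynomial.pderiv_C

theorem pderiv_trWord_of_length_ne (N : ℕ) (c : {c : Cycle (Fin n) // c ≠ Cycle.nil}) {w : Word n}
    (h : w.length ≠ c.1.length) : MvPolynomial.pderiv c (trWord N w) = 0 :=
  pderiv_trWord_of_ne N c fun e => h (by rw [← e, Cycle.length_coe])

theorem pderiv_trWord_self (N : ℕ) (c : {c : Cycle (Fin n) // c ≠ Cycle.nil}) {w : Word n}
    (h : (w : Cycle (Fin n)) = c.1) : MvPolynomial.pderiv c (trWord N w) = 1 := by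
  have hw : (w : Cycle (Fin n)) ≠ Cycle.nil := h ▸ c.2
  unfold trWord
  rw [dif_pos hw]
  have : (⟨(w : Cycle (Fin n)), hw⟩ : {c : Cycle (Fin n) // c ≠ Cycle.nil}) = c := Subtype.ext h
  rw [this, MvPolynomial.pderiv_X_self]

theorem isRotated_replicate_append {a b : Fin n} (hab : a ≠ b) {i : ℕ} {u v : Word n}
    (hu : u.length ≤ i) (h : (List.replicate i a ++ b :: u) ~r (List.replicate i a ++ b :: v)) :
    u = v := by
  have main : ∀ (r : ℕ) (u v : Word n), r ≤ i →
      (List.replicate i a ++ b :: u).rotate r = List.replicate i a ++ b :: v → r = 0 := by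
    intro r u v hr h
    by_contra h0
    have h1 := congrArg (fun l => l[i - r]?) h
    rw [List.getElem?_rotate (by simp; omega)] at h1
    have h2 : (i - r + r) % (List.replicate i a ++ b :: u).length = i := by
      rw [Nat.sub_add_cancel hr]
      exact Nat.mod_eq_of_lt (by simp)
    rw [h2, List.getElem?_append_right (by simp), List.getElem?_append_left (by simp; omega),
      List.getElem?_replicate, if_pos (by omega)] at h1
    simp at h1
    exact hab h1.symm
  obtain ⟨r, hr, e⟩ := List.isRotated_iff_mod.1 h
  have fin : ∀ {u v : Word n}, List.replicate i a ++ b :: u = List.replicate i a ++ b :: v →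
      u = v := by
    intro u v h
    simpa using List.append_cancel_left h
  rcases le_or_gt r i with hri | hri
  · obtain rfl := main r u v hri e
    rw [List.rotate_zero] at e
    exact fin e
  · have e' : (List.replicate i a ++ b :: v).rotate
        ((List.replicate i a ++ b :: u).length - r) = List.replicate i a ++ b :: u := by
      rw [← e, List.rotate_rotate, Nat.add_sub_cancel' hr, List.rotate_length]
    have h0 := main _ v u (by simp; omega) e'
    rw [h0, List.rotate_zero] at e'
    exact (fin e').symm

/-- There are arbitrarily long words `p` such that the cyclic word `p u` determines `u`, as long as
`u` is short. -/
theorem exists_marker (hn : 0 < n) (L M : ℕ) : ∃ p : Word n, M ≤ p.length ∧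
    ∀ u v : Word n, u.length ≤ L → v.length ≤ L → (p ++ u) ~r (p ++ v) → u = v := by
  by_cases h : ∃ a b : Fin n, a ≠ b
  · obtain ⟨a, b, hab⟩ := h
    refine ⟨List.replicate (L + M) a ++ [b], by simp; omega, fun u v hu _ huv => ?_⟩
    rw [List.append_assoc, List.append_assoc] at huv
    exact isRotated_replicate_append hab (by omega) huv
  · push Not at h
    refine ⟨List.replicate M ⟨0, hn⟩, by simp, fun u v _ _ huv => ?_⟩
    have hl : u.length = v.length := by simpa using huv.perm.length_eq
    exact List.ext_getElem hl fun i _ _ => h _ _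

/-- Products of two traces of long words are linearly independent over small coefficients, also
modulo single traces of long words. -/
theorem coeff_eq_zero_of_trace_pairing {ι κ : Type*} (hn : 0 < n) (N : ℕ) (S : Finset ι)
    (f : ι → TraceRing n) (u w : ι → Word n)
    (hinj : ∀ i j, u i = u j → w i = w j → i = j)
    (T : Finset κ) (g : κ → TraceRing n) (v : κ → Word n → Word n → Word n)
    (hv : ∀ j p q, p.length + q.length ≤ (v j p q).length)
    (h : ∀ p q, ∑ i ∈ S, f i * (trWord N (p ++ u i) * trWord N (w i ++ q)) +
      ∑ j ∈ T, g j * trWord N (v j p q) = 0) (i₀ : ι) (hi₀ : i₀ ∈ S) : f i₀ = 0 := by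
  classical
  let L := S.sup fun i => (u i).length + (w i).length
  let D := (S.sup fun i => (f i).vars.sup fun c => c.1.length) +
    T.sup fun j => (g j).vars.sup fun c => c.1.length
  have hL : ∀ i ∈ S, (u i).length + (w i).length ≤ L := fun i hi =>
    Finset.le_sup (f := fun i => (u i).length + (w i).length) hi
  have hDf : ∀ i ∈ S, ∀ c : {c : Cycle (Fin n) // c ≠ Cycle.nil}, D < c.1.length →
      MvPolynomial.pderiv c (f i) = 0 := by
    intro i hi c hc
    refine MvPolynomial.pderiv_eq_zero_of_notMem_vars fun hmem => ?_
    have h1 := Finset.le_sup (f := fun c : {c : Cycle (Fin n) // c ≠ Cycle.nil} => c.1.length) hmem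
    have h2 := Finset.le_sup (f := fun i => (f i).vars.sup fun c => c.1.length) hi
    omega
  have hDg : ∀ j ∈ T, ∀ c : {c : Cycle (Fin n) // c ≠ Cycle.nil}, D < c.1.length →
      MvPolynomial.pderiv c (g j) = 0 := by
    intro j hj c hc
    refine MvPolynomial.pderiv_eq_zero_of_notMem_vars fun hmem => ?_
    have h1 := Finset.le_sup (f := fun c : {c : Cycle (Fin n) // c ≠ Cycle.nil} => c.1.length) hmem
    have h2 := Finset.le_sup (f := fun j => (g j).vars.sup fun c => c.1.length) hj
    omega
  obtain ⟨p, hp, hp'⟩ := exists_marker hn L (D + 1)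
  obtain ⟨q, hq, hq'⟩ := exists_marker hn L (p.length + L + 1)
  have hL₀ := hL i₀ hi₀
  have hne₁ : p ++ u i₀ ≠ [] := fun e => by
    have := congrArg List.length e
    simp at this
    simp [this.1] at hp
  have hne₂ : w i₀ ++ q ≠ [] := fun e => by
    have := congrArg List.length e
    simp at this
    simp [this.2] at hq
  let c₁ : {c : Cycle (Fin n) // c ≠ Cycle.nil} :=
    ⟨((p ++ u i₀ : Word n) : Cycle (Fin n)), by simpa using hne₁⟩
  let c₂ : {c : Cycle (Fin n) // c ≠ Cycle.nil} :=
    ⟨((w i₀ ++ q : Word n) : Cycle (Fin n)), by simpa using hne₂⟩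
  have hc₁ : c₁.1.length = p.length + (u i₀).length := by
    simp only [c₁, Cycle.length_coe, List.length_append]
  have hc₂ : c₂.1.length = (w i₀).length + q.length := by
    simp only [c₂, Cycle.length_coe, List.length_append]
  have h' := congrArg (fun x => MvPolynomial.pderiv c₂ (MvPolynomial.pderiv c₁ x)) (h p q)
  simp only [map_add, map_sum, map_zero] at h'
  rw [Finset.sum_eq_single_of_mem i₀ hi₀, Finset.sum_eq_zero (s := T), add_zero] at h'
  · have h₁ : MvPolynomial.pderiv c₁ (trWord N (w i₀ ++ q)) = 0 :=
      pderiv_trWord_of_length_ne N _ (by rw [hc₁, List.length_append]; omega)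
    rw [MvPolynomial.pderiv_mul, MvPolynomial.pderiv_mul, hDf i₀ hi₀ c₁ (by omega), h₁,
      pderiv_trWord_self N c₁ rfl, zero_mul, zero_add, mul_zero, add_zero, one_mul,
      MvPolynomial.pderiv_mul, hDf i₀ hi₀ c₂ (by omega), pderiv_trWord_self N c₂ rfl] at h'
    simpa using h'
  · intro j hj
    have h₁ : MvPolynomial.pderiv c₁ (trWord N (v j p q)) = 0 :=
      pderiv_trWord_of_length_ne N _ (by have := hv j p q; omega)
    rw [MvPolynomial.pderiv_mul, hDg j hj c₁ (by omega), h₁, zero_mul, mul_zero, add_zero, map_zero]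
  · intro i hi hne
    have hLi := hL i hi
    have h₁ : MvPolynomial.pderiv c₁ (trWord N (w i ++ q)) = 0 :=
      pderiv_trWord_of_length_ne N _ (by rw [hc₁, List.length_append]; omega)
    rw [MvPolynomial.pderiv_mul, MvPolynomial.pderiv_mul, hDf i hi c₁ (by omega), h₁, zero_mul,
      zero_add, mul_zero, add_zero]
    by_cases hu : u i = u i₀
    · have hw : w i ≠ w i₀ := fun hw => hne (hinj i i₀ hu hw)
      have h₂ : MvPolynomial.pderiv c₂ (trWord N (w i ++ q)) = 0 := by
        refine pderiv_trWord_of_ne N _ fun e => hw ?_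
        refine hq' _ _ (by omega) (by omega) ?_
        exact List.isRotated_append.trans ((Cycle.coe_eq_coe.1 e).trans List.isRotated_append)
      rw [pderiv_trWord_self N c₁ (by rw [hu]), one_mul, MvPolynomial.pderiv_mul, h₂,
        hDf i hi c₂ (by omega), zero_mul, mul_zero, add_zero]
    · have h₂ : MvPolynomial.pderiv c₁ (trWord N (p ++ u i)) = 0 :=
        pderiv_trWord_of_ne N _ fun e => hu (hp' _ _ (by omega) (by omega) (Cycle.coe_eq_coe.1 e))
      rw [h₂, zero_mul, mul_zero, map_zero]

/-- The basis of `F ⊗ F` given by pairs of words. -/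
def pairBasis (n : ℕ) : Module.Basis (FreeMonoid (Fin n) × FreeMonoid (Fin n)) (TraceRing n)
    (Free n ⊗[TraceRing n] Free n) :=
  (FreeAlgebra.basisFreeMonoid _ _).tensorProduct (FreeAlgebra.basisFreeMonoid _ _)

theorem pairBasis_apply (i : FreeMonoid (Fin n) × FreeMonoid (Fin n)) :
    pairBasis n i = mono i.1.toList ⊗ₜ[TraceRing n] mono i.2.toList := by
  rw [pairBasis, Module.Basis.tensorProduct_apply]
  rfl

theorem apply_eq_sum_pairBasis (φ : (Free n ⊗[TraceRing n] Free n) →ₗ[TraceRing n] TraceRing n)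
    (t : Free n ⊗[TraceRing n] Free n) :
    φ t = ∑ i ∈ ((pairBasis n).repr t).support,
      (pairBasis n).repr t i * φ (mono i.1.toList ⊗ₜ mono i.2.toList) := by
  conv_lhs => rw [← (pairBasis n).linearCombination_repr t, Finsupp.linearCombination_apply,
    Finsupp.sum, map_sum]
  simp only [map_smul, smul_eq_mul, pairBasis_apply]

theorem eq_zero_of_trA_mulA (hn : 0 < n) (N : ℕ) (x : A n)
    (h : ∀ y, trA N (mulA N x y) = 0) : x = 0 := by
  obtain ⟨t, s⟩ := x
  have hsplit : ((t, s) : A n) = LinearMap.inl (TraceRing n) _ _ t +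
      LinearMap.inr (TraceRing n) _ _ s := by simp
  have key : ∀ y, ∑ i ∈ ((pairBasis n).repr t).support, (pairBasis n).repr t i *
        trA N (mulA N (tens (mono i.1.toList) (mono i.2.toList)) y) +
      ∑ i ∈ ((pairBasis n).repr s).support, (pairBasis n).repr s i *
        trA N (mulA N (box (mono i.1.toList) (mono i.2.toList)) y) = 0 := by
    intro y
    rw [← h y, hsplit, map_add, LinearMap.add_apply, map_add]
    congr 1
    · exact (apply_eq_sum_pairBasis
        (trA N ∘ₗ (mulA N).flip y ∘ₗ LinearMap.inl (TraceRing n) _ _) t).symm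
    · exact (apply_eq_sum_pairBasis
        (trA N ∘ₗ (mulA N).flip y ∘ₗ LinearMap.inr (TraceRing n) _ _) s).symm
  have hzero : ∀ z : Free n ⊗[TraceRing n] Free n,
      (∀ i ∈ ((pairBasis n).repr z).support, (pairBasis n).repr z i = 0) → z = 0 := by
    intro z hz
    apply (pairBasis n).repr.injective
    rw [map_zero]
    ext1 i
    by_contra hi
    exact hi (hz i (Finsupp.mem_support_iff.2 hi))
  have ht : t = 0 := by
    refine hzero t (coeff_eq_zero_of_trace_pairing hn N _ _ (fun i => i.1.toList)
      (fun i => i.2.toList) (fun i j h₁ h₂ => Prod.ext h₁ h₂)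
      ((pairBasis n).repr s).support ((pairBasis n).repr s)
      (fun j p q => j.1.toList ++ (p ++ (j.2.toList ++ q))) (fun j p q => by simp; omega)
      fun p q => ?_)
    rw [← key (tens (mono p) (mono q))]
    simp only [mulA_tens_tens, mulA_box_tens, trA_tens, trA_box, mono_mul, Tr_mono,
      List.append_assoc]
  have hs : s = 0 := by
    refine hzero s (coeff_eq_zero_of_trace_pairing hn N _ _ (fun i => i.2.toList)
      (fun i => i.1.toList) (fun i j h₁ h₂ => Prod.ext h₂ h₁)
      ((pairBasis n).repr t).support ((pairBasis n).repr t)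
      (fun j p q => j.2.toList ++ (p ++ (j.1.toList ++ q))) (fun j p q => by simp; omega)
      fun p q => ?_)
    rw [← key (box (mono p) (mono q)), add_comm]
    simp only [mulA_tens_box, mulA_box_box, trA_box, mono_mul, Tr_mono, map_smul, smul_eq_mul,
      List.append_assoc, trWord_append_comm N p]
  rw [ht, hs]
  rfl

theorem eq_zero_of_trMA_mulMA (hn : 0 < n) (N : ℕ) (X : MA n)
    (h : ∀ Y, trMA N (mulMA N X Y) = 0) : X = 0 := by
  ext1 a b
  refine eq_zero_of_trA_mulA hn N _ fun y => ?_
  have := h (Matrix.single b a y)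
  rw [trMA_apply, Finset.sum_eq_single a, mulMA_apply, Finset.sum_eq_single b] at this
  · simpa using this
  · intro c _ hc
    rw [Matrix.single_apply_of_row_ne hc.symm, map_zero]
  · simp
  · intro c _ hc
    rw [mulMA_apply, map_sum]
    refine Finset.sum_eq_zero fun d _ => ?_
    rw [Matrix.single_apply_of_col_ne _ _ hc.symm, map_zero, map_zero]
  · simp

/-! ### Multilinearity of iterated products -/

section Multilinear

variable (star : MA n →ₗ[TraceRing n] MA n →ₗ[TraceRing n] MA n)

theorem starProd_smul (k : ℕ) (c : Fin (k + 1) → TraceRing n) (f : Fin (k + 1) → MA n) :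
    starProd star k (fun i => c i • f i) = (∏ i, c i) • starProd star k f := by
  induction k with
  | zero => simp [starProd]
  | succ k ih =>
    rw [starProd, ih (fun i => c i.castSucc) (fun i => f i.castSucc), starProd,
      Fin.prod_univ_castSucc c]
    simp only [map_smul, LinearMap.smul_apply, smul_smul]
    rw [mul_comm]

theorem starProd_sum {S : Type*} [Fintype S] (k : ℕ) (v : S → MA n) :
    starProd star k (fun _ => ∑ s, v s) =
      ∑ s : Fin (k + 1) → S, starProd star k fun i => v (s i) := by
  induction k with
  | zero =>
    exact Fintype.sum_equiv (Equiv.funUnique (Fin 1) S).symm _ _ fun s => rfl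
  | succ k ih =>
    rw [starProd, ih]
    simp only [map_sum, LinearMap.sum_apply]
    rw [← Fintype.sum_prod_type']
    refine Fintype.sum_equiv (Fin.snocEquiv fun _ => S) _ _ fun p => ?_
    simp [starProd, Fin.snocEquiv]

end Multilinear

theorem generatesOnlyOneLoop_mulMA (N : ℕ) :
    GeneratesOnlyOneLoop N (mulMA N) (trMA N : MA n →ₗ[TraceRing n] TraceRing n) := by
  intro Γ k s
  simp only [Summand.value]
  rw [starProd_smul, map_smul, trMA_starProd, smul_eq_mul]

/-! ### Realizing marked vertices by interactions -/

theorem isInteraction_map_reverse {O : Operator n} (h : IsInteraction O) :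
    IsInteraction (O.map List.reverse) := by
  refine ⟨fun w hw => ?_, fun c hc => h.2 c ?_⟩
  · obtain ⟨w', hw', rfl⟩ := List.mem_map.1 hw
    simpa using h.1 w' hw'
  · have := congrArg (List.map List.reverse) hc
    simpa using this

/-- Interactions with prescribed vertices, all of which have coupling constant `1`. -/
theorem exists_interaction (T : Finset (Operator n)) (hT : ∀ O ∈ T, IsInteraction O) :
    ∃ Γ : Interaction n, ∀ O ∈ T, Γ.coupling O = 1 := by
  let T' := T ∪ T.image (List.map List.reverse)
  have hrev : ∀ O : Operator n, (O.map List.reverse).map List.reverse = O := by simp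
  have hrevT : ∀ O ∈ T', O.map List.reverse ∈ T' := by
    intro O hO
    rcases Finset.mem_union.1 hO with hO | hO
    · exact Finset.mem_union_right _ (Finset.mem_image_of_mem _ hO)
    · obtain ⟨O', hO', rfl⟩ := Finset.mem_image.1 hO
      rw [hrev]
      exact Finset.mem_union_left _ hO'
  have hmem : ∀ O, O.map List.reverse ∈ T' ↔ O ∈ T' := fun O =>
    ⟨fun h => hrev O ▸ hrevT _ h, hrevT O⟩
  refine ⟨⟨Finsupp.indicator T' fun _ _ => 1, ?_, ?_⟩, ?_⟩
  · intro O hO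
    replace hO : O ∈ T' := Finsupp.support_indicator_subset _ _ hO
    rcases Finset.mem_union.1 hO with hO | hO
    · exact hT O hO
    · obtain ⟨O', hO', rfl⟩ := Finset.mem_image.1 hO
      exact isInteraction_map_reverse (hT O' hO')
  · intro O
    by_cases h : O ∈ T'
    · simp [Finsupp.indicator_apply, h, hmem]
    · simp [Finsupp.indicator_apply, h, hmem]
  · intro O hO
    have : O ∈ T' := Finset.mem_union_left _ hO
    simp [Finsupp.indicator_apply, this]

/-- Up to spectator traces, every marked vertex occurs in some interaction vertex. -/
theorem exists_operator_mark (m : MarkedVertex n) :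
    ∃ O : Operator n, IsInteraction O ∧ ∃ μ : Mark O,
      μ.vertex = { m with spect := μ.vertex.spect } := by
  rcases m with ⟨a, b, x, y, s, l₀⟩
  cases s
  · refine ⟨[b :: (x ++ a :: y), [a]], ⟨by simp, by simp⟩,
      Sum.inl ⟨⟨0, by simp⟩, ⟨0, by simp⟩, ⟨x.length, ?_⟩⟩, ?_⟩
    · simp [excise]
    · simp only [Mark.vertex, excise]
      congr 1 <;> simp
  · refine ⟨[a :: x, b :: y], ⟨by simp, by simp⟩,
      Sum.inr ⟨⟨(⟨0, by simp⟩, ⟨1, by simp⟩), by simp⟩, ⟨0, by simp⟩, ⟨0, by simp⟩⟩, ?_⟩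
    simp only [Mark.vertex, excise]
    congr 1 <;> simp

theorem MarkedVertex.entry_eq_smul (N : ℕ) (m : MarkedVertex n) :
    m.entry N = trProd N m.spect • { m with spect := [] : MarkedVertex n }.entry N := by
  simp [MarkedVertex.entry, trProd, Matrix.smul_single]

theorem exists_summands {N : ℕ} (hN : 0 < N) {k : ℕ} (m : Fin (k + 1) → MarkedVertex n)
    (hm : ∀ i, (m i).spect = []) :
    ∃ (Γ : Interaction n) (s : Fin (k + 1) → Summand Γ) (c : Fin (k + 1) → TraceRing n),
      (∀ i, c i ≠ 0) ∧ ∀ i, (s i).value N = c i • (m i).entry N := by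
  choose O hO μ hμ using fun i => exists_operator_mark (m i)
  obtain ⟨Γ, hΓ⟩ := exists_interaction (Finset.univ.image O) (by
    intro P hP
    obtain ⟨i, -, rfl⟩ := Finset.mem_image.1 hP
    exact hO i)
  have hΓ' : ∀ i, Γ.coupling (O i) = 1 := fun i =>
    hΓ _ (Finset.mem_image_of_mem _ (Finset.mem_univ i))
  refine ⟨Γ, fun i => ⟨⟨O i, by simp [hΓ']⟩, μ i⟩, fun i => trProd N (μ i).vertex.spect,
    fun i => trProd_ne_zero hN _, fun i => ?_⟩
  have hv : Summand.vertex (⟨⟨O i, by simp [hΓ']⟩, μ i⟩ : Summand Γ) =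
      { m i with spect := (μ i).vertex.spect } := hμ i
  rw [Summand.value, hv, Summand.coupling, hΓ', map_one, one_smul, MarkedVertex.entry_eq_smul]
  rw [← hm i]

theorem MA_linearMap_ext {X : Type*} [AddCommMonoid X] [Module (TraceRing n) X] (N : ℕ)
    {φ ψ : MA n →ₗ[TraceRing n] X}
    (h : ∀ m : MarkedVertex n, m.spect = [] → φ (m.entry N) = ψ (m.entry N)) : φ = ψ := by
  refine Matrix.ext_linearMap (TraceRing n) fun a b => ?_
  refine LinearMap.prod_ext ((pairBasis n).ext fun i => ?_) ((pairBasis n).ext fun i => ?_)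
  · have := h ⟨a, b, i.1.toList, i.2.toList, false, []⟩ rfl
    rw [pairBasis_apply]
    simpa [MarkedVertex.entry, trProd, tens] using this
  · have := h ⟨a, b, i.1.toList, i.2.toList, true, []⟩ rfl
    rw [pairBasis_apply]
    simpa [MarkedVertex.entry, trProd, box] using this

theorem eq_of_trMA_mulMA (hn : 0 < n) (N : ℕ) (X Y : MA n)
    (h : ∀ Z, trMA N (mulMA N X Z) = trMA N (mulMA N Y Z)) : X = Y := by
  have h0 : X + (-1 : TraceRing n) • Y = 0 := by
    refine eq_zero_of_trMA_mulMA hn N _ fun Z => ?_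
    rw [map_add, map_smul, LinearMap.add_apply, LinearMap.smul_apply, map_add, map_smul, h Z,
      smul_eq_mul, neg_one_mul, add_neg_cancel]
  have h1 : (-1 : TraceRing n) • Y + Y = 0 := by
    calc (-1 : TraceRing n) • Y + Y = (-1 : TraceRing n) • Y + (1 : TraceRing n) • Y := by
          rw [one_smul]
      _ = 0 := by rw [← add_smul, neg_add_cancel, zero_smul]
  calc X = X + ((-1 : TraceRing n) • Y + Y) := by rw [h1, add_zero]
    _ = Y := by rw [← add_assoc, h0, zero_add]

section Uniqueness

variable {N : ℕ} {star : MA n →ₗ[TraceRing n] MA n →ₗ[TraceRing n] MA n}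
  {STr : MA n →ₗ[TraceRing n] TraceRing n}

theorem GeneratesOnlyOneLoop.apply_starProd_entry (h : GeneratesOnlyOneLoop N star STr)
    (hN : 0 < N) {k : ℕ} (m : Fin (k + 1) → MarkedVertex n) (hm : ∀ i, (m i).spect = []) :
    STr (starProd star k fun i => (m i).entry N) =
      trMA N (starProd (mulMA N) k fun i => (m i).entry N) := by
  obtain ⟨Γ, s, c, hc, hs⟩ := exists_summands hN m hm
  have h' := (h Γ k s).trans (generatesOnlyOneLoop_mulMA N Γ k s).symm
  simp only [hs] at h'
  rw [starProd_smul, starProd_smul, map_smul, map_smul, smul_eq_mul, smul_eq_mul] at h'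
  exact mul_left_cancel₀ (Finset.prod_ne_zero_iff.2 fun i _ => hc i) h'

theorem GeneratesOnlyOneLoop.eq_trMA (h : GeneratesOnlyOneLoop N star STr) (hN : 0 < N) :
    STr = trMA N :=
  MA_linearMap_ext N fun m hm => h.apply_starProd_entry hN (k := 0) (fun _ => m) fun _ => hm

theorem GeneratesOnlyOneLoop.trMA_star (h : GeneratesOnlyOneLoop N star STr) (hN : 0 < N)
    (X Y : MA n) : trMA N (star X Y) = trMA N (mulMA N X Y) := by
  have : star.compr₂ (trMA N) = (mulMA N).compr₂ (trMA N) := by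
    refine MA_linearMap_ext N fun m hm => MA_linearMap_ext N fun m' hm' => ?_
    have := h.apply_starProd_entry hN (k := 1) ![m, m'] (by simp [Fin.forall_fin_succ, hm, hm'])
    rw [h.eq_trMA hN] at this
    exact this
  exact LinearMap.congr_fun₂ this X Y

theorem GeneratesOnlyOneLoop.trMA_star_star (h : GeneratesOnlyOneLoop N star STr) (hN : 0 < N)
    (m₀ m₁ : MarkedVertex n) (h₀ : m₀.spect = []) (h₁ : m₁.spect = []) (Z : MA n) :
    trMA N (star (star (m₀.entry N) (m₁.entry N)) Z) =
      trMA N (mulMA N (mulMA N (m₀.entry N) (m₁.entry N)) Z) := by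
  have : trMA N ∘ₗ star (star (m₀.entry N) (m₁.entry N)) =
      trMA N ∘ₗ mulMA N (mulMA N (m₀.entry N) (m₁.entry N)) := by
    refine MA_linearMap_ext N fun m hm => ?_
    have := h.apply_starProd_entry hN (k := 2) ![m₀, m₁, m]
      (by simp [Fin.forall_fin_succ, hm, h₀, h₁])
    rw [h.eq_trMA hN] at this
    exact this
  exact LinearMap.congr_fun this Z

theorem GeneratesOnlyOneLoop.eq_mulMA (h : GeneratesOnlyOneLoop N star STr) (hn : 0 < n)
    (hN : 0 < N) : star = mulMA N := by
  refine MA_linearMap_ext N fun m hm => ?_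
  refine MA_linearMap_ext N fun m' hm' => ?_
  refine eq_of_trMA_mulMA hn N _ _ fun Z => ?_
  exact (h.trMA_star hN _ Z).symm.trans (h.trMA_star_star hN m m' hm hm' Z)

end Uniqueness

theorem generatesOnlyOneLoop_iff (hn : 0 < n) {N : ℕ} (hN : 0 < N)
    (star : MA n →ₗ[TraceRing n] MA n →ₗ[TraceRing n] MA n)
    (STr : MA n →ₗ[TraceRing n] TraceRing n) :
    GeneratesOnlyOneLoop N star STr ↔ star = mulMA N ∧ STr = trMA N :=
  ⟨fun h => ⟨h.eq_mulMA hn hN, h.eq_trMA hN⟩, by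
    rintro ⟨rfl, rfl⟩
    exact generatesOnlyOneLoop_mulMA N⟩

theorem GeneratesOnlyOneLoop.wetterichTerm_eq {N : ℕ}
    {star : MA n →ₗ[TraceRing n] MA n →ₗ[TraceRing n] MA n}
    {STr : MA n →ₗ[TraceRing n] TraceRing n} (h : GeneratesOnlyOneLoop N star STr)
    (Γ : Interaction n) (k : ℕ) :
    wetterichTerm N star STr Γ k =
      MvPolynomial.C ((1 / 2 : ℂ) * (-1) ^ (k + 1)) *
        ∑ s : Fin (k + 1) → Summand Γ,
          (∏ i, (s i).coupling) * loopContribution N fun i => (s i).vertex := by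
  rw [wetterichTerm, hess_eq_sum, starProd_sum, map_sum]
  simp only [h Γ k]

end FRG
end

theorem theorem1 (n N : ℕ) (hn : 0 < n) (hN : 0 < N) :
    ∃ (mul : FRG.A n →ₗ[FRG.TraceRing n] FRG.A n →ₗ[FRG.TraceRing n] FRG.A n)
      (trA : FRG.A n →ₗ[FRG.TraceRing n] FRG.TraceRing n),
      -- the four multiplication rules
      (∀ U W P Q : FRG.Free n,
        mul (FRG.tens U W) (FRG.tens P Q) = FRG.tens (P * U) (W * Q) ∧
        mul (FRG.box U W) (FRG.tens P Q) = FRG.box U (P * W * Q) ∧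
        mul (FRG.tens U W) (FRG.box P Q) = FRG.box (W * P * U) Q ∧
        mul (FRG.box U W) (FRG.box P Q) = FRG.Tr N (W * P) • FRG.box U Q) ∧
      -- the trace
      (∀ P Q : FRG.Free n,
        trA (FRG.tens P Q) = FRG.Tr N P * FRG.Tr N Q ∧ trA (FRG.box P Q) = FRG.Tr N (P * Q)) ∧
      -- the product is associative and unital
      (∀ x y z, mul (mul x y) z = mul x (mul y z)) ∧
      (∀ x, mul (FRG.tens 1 1) x = x ∧ mul x (FRG.tens 1 1) = x) ∧
      -- one-loop structure holds for the matrix algebra over this algebra, and only for it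
      (∀ (star : FRG.MA n →ₗ[FRG.TraceRing n] FRG.MA n →ₗ[FRG.TraceRing n] FRG.MA n)
        (STr : FRG.MA n →ₗ[FRG.TraceRing n] FRG.TraceRing n),
        FRG.GeneratesOnlyOneLoop N star STr ↔
          (∀ F G a c, star F G a c = ∑ b, mul (F a b) (G b c)) ∧
          (∀ F, STr F = ∑ a, trA (F a a))) ∧
      -- the powers of the Hessian are then sums over one-loop graphs
      (∀ (star : FRG.MA n →ₗ[FRG.TraceRing n] FRG.MA n →ₗ[FRG.TraceRing n] FRG.MA n)
        (STr : FRG.MA n →ₗ[FRG.TraceRing n] FRG.TraceRing n),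
        FRG.GeneratesOnlyOneLoop N star STr →
          ∀ (Γ : FRG.Interaction n) (k : ℕ),
            FRG.wetterichTerm N star STr Γ k =
              MvPolynomial.C ((1 / 2 : ℂ) * (-1) ^ (k + 1)) *
                ∑ s : Fin (k + 1) → FRG.Summand Γ,
                  (∏ i, (s i).coupling) * FRG.loopContribution N fun i => (s i).vertex) := by
  refine ⟨FRG.mulA N, FRG.trA N, fun U W P Q => ⟨FRG.mulA_tens_tens N U W P Q,
    FRG.mulA_box_tens N U W P Q, FRG.mulA_tens_box N U W P Q, FRG.mulA_box_box N U W P Q⟩,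
    fun P Q => ⟨FRG.trA_tens N P Q, FRG.trA_box N P Q⟩, FRG.mulA_assoc N, FRG.mulA_one N,
    fun star STr => ?_, fun star STr h => h.wetterichTerm_eq⟩
  rw [FRG.generatesOnlyOneLoop_iff hn hN]
  refine and_congr ⟨?_, fun h => ?_⟩ ⟨?_, fun h => ?_⟩
  · rintro rfl F G a c
    exact FRG.mulMA_apply N F G a c
  · refine LinearMap.ext₂ fun F G => ?_
    ext1 a c
    rw [h, FRG.mulMA_apply]
  · rintro rfl F
    exact FRG.trMA_apply N F
  · refine LinearMap.ext fun F => ?_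
    rw [h, FRG.trMA_apply]
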